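/- Let $n\ge 1$, let $(\Omega,\mathcal A,\mathbb P)$ be a probability space with a filtration $\mathcal F=(\mathcal F_k)_{0\le k\le n-1}$, and let $V_0,\dots,V_{n-1}$ be integrable random variables such that $V_k$ is $\mathcal F_k$-measurable. Let $T^+(n)=\{(u,v)\in\mathbb R^2:\ 0\le u\le v\le n\}$. For $Q=(Q_{\min},Q_{\max})\in T^+(n)$, an *admissible control* is a sequence $q=(q_k)_{0\le k\le n-1}$ of $[0,1]$-valued random variables, $q_k$ being $\mathcal F_k$-measurable, with $\sum_{k=0}^{n-1}q_k\in[Q_{\min},Q_{\max}]$. The *premium* is $$P_0(Q)=\operatorname{ess\,sup}\Big\{\mathbb E\Big(\sum_{k=0}^{n-1}q_kV_k\,\Big|\,\mathcal F_0\Big):\ q \text{ admissible for } Q\Big\},$$ and an admissible control $q$ is *optimal* if $\mathbb E(\sum_{k}q_kV_k\mid\mathcal F_0)=P_0(Q)$ a.s. It is *bang-bang* if, almost surely, either $q_k\in\{0,1\wedge Q_{\max}\}$ for every $k$, or at most one $q_k$ lies in $(0,1\wedge Q_{\max})$ and $\sum_k q_k\in\{Q_{\min},Q_{\max}\}$. For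 integers $i,j$ put $$T^{+}_{ij}=\{(u,v)\in[i,i+1]\times[j,j+1]:\ v\ge u+j-i\},\qquad T^{-}_{ij}=\{(u,v)\in[i,i+1]\times[j,j+1]:\ v\le u+j-i\}.$$ Then for every $Q\in T^+(n)$ the essential supremum $P_0(Q)$ is well defined and is attained by an optimal control. Moreover: (a) *Value function.* There is a process $(Q,\omega)\mapsto P(Q,\omega)$ on $T^+(n)\times\Omega$ such that, for each $Q\in T^+(n)$, $P(Q,\cdot)$ is $\mathcal F_0$-measurable and equal to $P_0(Q)$ a.s., and such that, for every $\omega$, the map $Q\mapsto P(Q,\omega)$ is concave and continuous on $T^+(n)$ and affine on each triangle $T^+_{ij}$ ($0\le i\le j\le n-1$) and $T^-_{ij}$ ($0\le i<j\le n-1$) of the tiling of $T^+(n)$ (hence piecewise affine). Almost surely, $$P_0(0,0)=0,\qquad P_0(0,n)=\mathbb E\Big(\sum_{k=0}^{n-1}V_k^+\,\Big|\,\mathcal F_0\Big),\qquad P_0(n,n)=\mathbb E\Big(\sum_{k=0}^{n-1}V_k\,\Big|\,\mathcal F_0\Big).$$ If $V_k\ge0$ a.s. for every $k$, then for every $Q\in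 T^+(n)$, $P_0(Q)=P_0(0,Q_{\max})=P_0(Q_{\max},Q_{\max})$ a.s., and $v\mapsto P((v,v),\omega)$ is non-decreasing on $[0,n]$ for almost every $\omega$. (b) *Optimal control.* If $Q\in T^+(n)\cap\mathbb N^2$, there is a bang-bang optimal control all of whose components are $\{0,1\}$-valued. If $V_k\ge0$ a.s. for every $k$, then for every $Q\in T^+(n)$ there is a bang-bang optimal control with $\sum_{k=0}^{n-1}q_k=Q_{\max}$. In general a bang-bang optimal control need not exist: already for $n=2$ there are a probability space, a filtration, integrable adapted payoffs $V_0,V_1$ and constraints $Q\in T^+(2)$ for which no optimal control is bang-bang. -/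

import Mathlib

open MeasureTheory

namespace Swing

/-- `X` is the essential supremum under `μ` of the family `S` of random variables: the smallest
random variable (up to null sets) that dominates every member of `S` almost surely. -/
def IsEssSup {Ω : Type*} [MeasurableSpace Ω] (μ : Measure Ω) (S : Set (Ω → ℝ)) (X : Ω → ℝ) :
    Prop :=
  Measurable X ∧ (∀ f ∈ S, f ≤ᵐ[μ] X) ∧
    ∀ Y : Ω → ℝ, Measurable Y → (∀ f ∈ S, f ≤ᵐ[μ] Y) → X ≤ᵐ[μ] Y

open Classical in
/-- The essential supremum of a family of random variables (a chosen version; it is unique up to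
null sets), with default value `0` when there is none. -/
noncomputable def esssup {Ω : Type*} [MeasurableSpace Ω] (μ : Measure Ω) (S : Set (Ω → ℝ)) :
    Ω → ℝ :=
  if h : ∃ X, IsEssSup μ S X then h.choose else 0

/-- The set `T⁺(n) = {(u, v) : 0 ≤ u ≤ v ≤ n}` of deterministic global constraints. -/
def constraintSet (n : ℕ) : Set (ℝ × ℝ) :=
  {Q | 0 ≤ Q.1 ∧ Q.1 ≤ Q.2 ∧ Q.2 ≤ n}

/-- The upper triangle `T⁺ᵢⱼ` of the unit square `[i, i+1] × [j, j+1]`. -/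
def upperTriangle (i j : ℕ) : Set (ℝ × ℝ) :=
  {Q | Q.1 ∈ Set.Icc (i : ℝ) (i + 1) ∧ Q.2 ∈ Set.Icc (j : ℝ) (j + 1) ∧
    Q.1 + (j : ℝ) - (i : ℝ) ≤ Q.2}

/-- The lower triangle `T⁻ᵢⱼ` of the unit square `[i, i+1] × [j, j+1]`. -/
def lowerTriangle (i j : ℕ) : Set (ℝ × ℝ) :=
  {Q | Q.1 ∈ Set.Icc (i : ℝ) (i + 1) ∧ Q.2 ∈ Set.Icc (j : ℝ) (j + 1) ∧
    Q.2 ≤ Q.1 + (j : ℝ) - (i : ℝ)}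

/-- The restriction of `f` to `s` is an affine function of the two coordinates. -/
def IsAffineOn (f : ℝ × ℝ → ℝ) (s : Set (ℝ × ℝ)) : Prop :=
  ∃ a b c : ℝ, ∀ Q ∈ s, f Q = a * Q.1 + b * Q.2 + c

/-- `(q₀, …, qₙ₋₁)` is an `(ℱ, Q)`-admissible control: it is adapted, `[0, 1]`-valued, and the
total purchased quantity lies in `[Q.1, Q.2]`. Only the indices `k < n` matter. -/
def IsAdmissible {Ω : Type*} [mΩ : MeasurableSpace Ω] (ℱ : Filtration ℕ mΩ) (n : ℕ) (Q : ℝ × ℝ)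
    (q : ℕ → Ω → ℝ) : Prop :=
  (∀ k < n, Measurable[ℱ k] (q k)) ∧
  (∀ k < n, ∀ ω, q k ω ∈ Set.Icc (0 : ℝ) 1) ∧
  ∀ ω, ∑ k ∈ Finset.range n, q k ω ∈ Set.Icc Q.1 Q.2

/-- The conditional expected reward `E(∑_{k < n} q_k V_k | ℱ₀)` of a control. -/
noncomputable def reward {Ω : Type*} [mΩ : MeasurableSpace Ω] (μ : Measure Ω)
    (ℱ : Filtration ℕ mΩ) (n : ℕ) (V q : ℕ → Ω → ℝ) : Ω → ℝ :=
  μ[fun ω => ∑ k ∈ Finset.range n, q k ω * V k ω | ℱ 0]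

/-- The rewards of all `(ℱ, Q)`-admissible controls. -/
def rewardSet {Ω : Type*} [mΩ : MeasurableSpace Ω] (μ : Measure Ω) (ℱ : Filtration ℕ mΩ) (n : ℕ)
    (V : ℕ → Ω → ℝ) (Q : ℝ × ℝ) : Set (Ω → ℝ) :=
  {X | ∃ q, IsAdmissible ℱ n Q q ∧ X = reward μ ℱ n V q}

/-- The premium `P₀ⁿ(Q)` of the swing option with global constraints `Q = (Qmin, Qmax)`. -/
noncomputable def premium {Ω : Type*} [mΩ : MeasurableSpace Ω] (μ : Measure Ω)
    (ℱ : Filtration ℕ mΩ) (n : ℕ) (V : ℕ → Ω → ℝ) (Q : ℝ × ℝ) : Ω → ℝ :=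
  esssup μ (rewardSet μ ℱ n V Q)

/-- An optimal control: an admissible control whose reward is the premium. -/
def IsOptimal {Ω : Type*} [mΩ : MeasurableSpace Ω] (μ : Measure Ω) (ℱ : Filtration ℕ mΩ) (n : ℕ)
    (V : ℕ → Ω → ℝ) (Q : ℝ × ℝ) (q : ℕ → Ω → ℝ) : Prop :=
  IsAdmissible ℱ n Q q ∧ reward μ ℱ n V q =ᵐ[μ] premium μ ℱ n V Q

/-- Bang-bang controls: almost surely, either every local constraint is saturated, i.e. every
`q_k` is in `{0, 1 ∧ Qmax}`, or at most one `q_k` lies in `(0, 1 ∧ Qmax)` and one of the two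
global constraints is saturated. -/
def IsBangBang {Ω : Type*} [MeasurableSpace Ω] (μ : Measure Ω) (n : ℕ) (Q : ℝ × ℝ)
    (q : ℕ → Ω → ℝ) : Prop :=
  ∀ᵐ ω ∂μ,
    (∀ k < n, q k ω = 0 ∨ q k ω = min 1 Q.2) ∨
    ({k | k < n ∧ q k ω ∈ Set.Ioo 0 (min 1 Q.2)}.Subsingleton ∧
      (∑ k ∈ Finset.range n, q k ω = Q.1 ∨ ∑ k ∈ Finset.range n, q k ω = Q.2))

end Swing

/-!
The controls for real constraints are reduced to `{0, 1}`-valued controls for integer constraints by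
randomized rounding. Let `q` be admissible for `Q = (u, v)` with cumulative quantities `S_k`. For
`θ ∈ [0, 1)` the increments of `⌊S_k + θ⌋` form an adapted `{0, 1}`-valued control, admissible for
`(⌊u + θ⌋, ⌊v + θ⌋)`, and `q` is the average of these controls over `θ`
(`integral_payoff_roundedControl`). The points `(⌊u + θ⌋, ⌊v + θ⌋)` are the vertices of the triangle
of the tiling that contains `Q`, and they occur with probabilities equal to the barycentric
coordinates of `Q`, given by `hatWeight`. Hence no control beats the interpolation of the optimal
integer values (`setIntegral_payoff_le`). Conversely, the mixture of optimal integer controls with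
the same weights is admissible for `Q` and attains this bound (`isOptimal_mixedControl`). So the
premium at `Q` is the interpolation of its values at the vertices (`premium_eq_interpolation`), and
this formula is a version with continuous, piecewise affine paths; concavity holds on a countable
dense set almost surely because mixtures of controls are controls (`exists_regular_version`).

Optimal integer controls come from dynamic programming (`exists_nested_isBinaryOptimal`). For an
exact number `c` of exercise dates the optimal controls `q_c` are built so as to be nested in `c`.
Nestedness carries the induction: `q_{c-1} + q_{c+1} - q_c` is then a control with `c` exercise
dates, so the value is concave in `c`, the exercise regions are increasing in `c`, and nestedness is
preserved. Bounds `a ≤ b` are reduced to the exact number `b` by adding `b - a` periods with zero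
payoff (`exists_isBinaryOptimal`).

For nonnegative payoffs any control can be increased to a total of `Q.2`
(`exists_isAdmissible_ge`), and for the exact total `m + s` with `s ∈ [0, 1]` the mixture
`(1 - s) q_m + s q_{m+1}` is optimal. By nestedness it has at most one fractional component, so it
is bang-bang (`exists_isBangBang_diag`).
-/

namespace Swing

/-! ### Hat functions of the tiling and rounding of points -/

section

/-- The hat function of the vertex `(i, j)` for the tiling by the triangles `T⁺ᵢⱼ`, `T⁻ᵢⱼ`. It is
also the probability that `(⌊Q.1 + θ⌋, ⌊Q.2 + θ⌋) = (i, j)` for `θ` uniform on `[0, 1)`. -/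
noncomputable def hatWeight (i j : ℕ) (Q : ℝ × ℝ) : ℝ :=
  max 0 (1 - max (max (Q.1 - i) (Q.2 - j)) 0 + min (min (Q.1 - i) (Q.2 - j)) 0)

lemma hatWeight_nonneg (i j : ℕ) (Q : ℝ × ℝ) : 0 ≤ hatWeight i j Q := le_max_left _ _

lemma continuous_hatWeight (i j : ℕ) : Continuous (hatWeight i j) := by
  unfold hatWeight
  fun_prop

lemma isAffineOn_hatWeight_upperTriangle (i' j' i j : ℕ) :
    IsAffineOn (hatWeight i' j') (upperTriangle i j) := by
  have zero : (∀ Q ∈ upperTriangle i j, hatWeight i' j' Q = 0) →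
      IsAffineOn (hatWeight i' j') (upperTriangle i j) := fun h =>
    ⟨0, 0, 0, fun Q hQ => by rw [h Q hQ]; ring⟩
  rcases lt_trichotomy i' i with hi | rfl | hi
  · refine zero fun Q hQ => max_eq_left ?_
    have : (i' : ℝ) + 1 ≤ i := by exact_mod_cast hi
    have h1 := hQ.1.1
    have h2 := le_max_left (Q.1 - i') (Q.2 - j')
    have h3 := le_max_left (max (Q.1 - i') (Q.2 - j')) 0
    have h4 := min_le_right (min (Q.1 - i') (Q.2 - j')) 0
    linarith
  · rcases lt_trichotomy j' j with hj | rfl | hj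
    · refine zero fun Q hQ => max_eq_left ?_
      have : (j' : ℝ) + 1 ≤ j := by exact_mod_cast hj
      have h1 := hQ.2.1.1
      have h2 := le_max_right (Q.1 - i') (Q.2 - j')
      have h3 := le_max_left (max (Q.1 - i') (Q.2 - j')) 0
      have h4 := min_le_right (min (Q.1 - i') (Q.2 - j')) 0
      linarith
    · refine ⟨0, -1, 1 + j', fun Q ⟨hu, hv, h⟩ => ?_⟩
      obtain ⟨hu0, hu1⟩ := hu
      obtain ⟨hv0, hv1⟩ := hv
      rw [hatWeight, max_eq_right (a := Q.1 - i') (by linarith), max_eq_left (b := 0) (by linarith),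
        min_eq_right (b := 0) (by rw [le_min_iff]; constructor <;> linarith),
        max_eq_right (by linarith)]
      ring
    · obtain hj | rfl : j + 2 ≤ j' ∨ j' = j + 1 := by omega
      · refine zero fun Q hQ => max_eq_left ?_
        have : (j : ℝ) + 2 ≤ j' := by exact_mod_cast hj
        have h1 := hQ.2.1.2
        have h2 := min_le_right (Q.1 - i') (Q.2 - j')
        have h3 := le_max_right (max (Q.1 - i') (Q.2 - j')) 0
        have h4 := min_le_left (min (Q.1 - i') (Q.2 - j')) 0
        linarith
      · refine ⟨-1, 1, i' - j, fun Q ⟨hu, hv, h⟩ => ?_⟩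
        obtain ⟨hu0, hu1⟩ := hu
        obtain ⟨hv0, hv1⟩ := hv
        rw [hatWeight]
        push_cast
        rw [max_eq_left (a := Q.1 - i') (by linarith), max_eq_left (b := 0) (by linarith),
          min_eq_right (a := Q.1 - i') (by linarith), min_eq_left (b := 0) (by linarith),
          max_eq_right (by linarith)]
        ring
  · obtain hi | rfl : i + 2 ≤ i' ∨ i' = i + 1 := by omega
    · refine zero fun Q hQ => max_eq_left ?_
      have : (i : ℝ) + 2 ≤ i' := by exact_mod_cast hi
      have h1 := hQ.1.2
      have h2 := min_le_left (Q.1 - i') (Q.2 - j')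
      have h3 := le_max_right (max (Q.1 - i') (Q.2 - j')) 0
      have h4 := min_le_left (min (Q.1 - i') (Q.2 - j')) 0
      linarith
    · obtain hj | rfl | hj : j' < j ∨ j' = j ∨ j < j' := by omega
      · refine zero fun Q hQ => max_eq_left ?_
        have : (j' : ℝ) + 1 ≤ j := by exact_mod_cast hj
        have h1 := hQ.2.1.1
        have h2 := le_max_right (Q.1 - (i + 1 : ℕ)) (Q.2 - j')
        have h3 := le_max_left (max (Q.1 - (i + 1 : ℕ)) (Q.2 - j')) 0
        have h4 := min_le_right (min (Q.1 - (i + 1 : ℕ)) (Q.2 - j')) 0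
        linarith
      · refine zero fun Q ⟨hu, hv, h⟩ => max_eq_left ?_
        have h2 := le_max_right (Q.1 - (i + 1 : ℕ)) (Q.2 - j')
        have h3 := le_max_left (max (Q.1 - (i + 1 : ℕ)) (Q.2 - j')) 0
        have h4 := min_le_left (min (Q.1 - (i + 1 : ℕ)) (Q.2 - j')) 0
        have h5 := min_le_left (Q.1 - (i + 1 : ℕ)) (Q.2 - j')
        push_cast at *
        linarith
      · obtain hj | rfl : j + 2 ≤ j' ∨ j' = j + 1 := by omega
        · refine zero fun Q hQ => max_eq_left ?_
          have : (j : ℝ) + 2 ≤ j' := by exact_mod_cast hj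
          have h1 := hQ.2.1.2
          have h2 := min_le_right (Q.1 - (i + 1 : ℕ)) (Q.2 - j')
          have h3 := le_max_right (max (Q.1 - (i + 1 : ℕ)) (Q.2 - j')) 0
          have h4 := min_le_left (min (Q.1 - (i + 1 : ℕ)) (Q.2 - j')) 0
          linarith
        · refine ⟨1, 0, -i, fun Q ⟨hu, hv, h⟩ => ?_⟩
          obtain ⟨hu0, hu1⟩ := hu
          obtain ⟨hv0, hv1⟩ := hv
          rw [hatWeight]
          push_cast
          rw [max_eq_right (b := 0) (by rw [max_le_iff]; constructor <;> linarith),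
            min_eq_left (a := Q.1 - (i + 1)) (by linarith), min_eq_left (b := 0) (by linarith),
            max_eq_right (by linarith)]
          ring

/-- The hat functions are symmetric under the exchange of the two coordinates, which maps lower
triangles to upper triangles. -/
lemma isAffineOn_hatWeight_lowerTriangle (i' j' i j : ℕ) :
    IsAffineOn (hatWeight i' j') (lowerTriangle i j) := by
  obtain ⟨a, b, c, h⟩ := isAffineOn_hatWeight_upperTriangle j' i' j i
  refine ⟨b, a, c, fun Q hQ => ?_⟩
  have hswap : hatWeight i' j' Q = hatWeight j' i' Q.swap := by
    simp only [hatWeight, Prod.fst_swap, Prod.snd_swap]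
    rw [max_comm (Q.1 - _), min_comm (Q.1 - _)]
  have := h Q.swap ⟨hQ.2.1, hQ.1, by simpa using by linarith [hQ.2.2]⟩
  rw [hswap, this, Prod.fst_swap, Prod.snd_swap]
  ring

lemma measurable_natFloor_add (u : ℝ) : Measurable fun θ : ℝ => ⌊u + θ⌋₊ :=
  Nat.measurable_floor.comp (measurable_const_add u)

lemma volume_real_floor_add_eq (i j : ℕ) {Q : ℝ × ℝ} (h1 : 0 ≤ Q.1) (h2 : 0 ≤ Q.2) :
    (volume.restrict (Set.Ico (0 : ℝ) 1)).real {θ | ⌊Q.1 + θ⌋₊ = i ∧ ⌊Q.2 + θ⌋₊ = j} =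
      hatWeight i j Q := by
  have hm : MeasurableSet {θ : ℝ | ⌊Q.1 + θ⌋₊ = i ∧ ⌊Q.2 + θ⌋₊ = j} :=
    (measurable_natFloor_add Q.1 (measurableSet_singleton i)).inter
      (measurable_natFloor_add Q.2 (measurableSet_singleton j))
  have hset : {θ : ℝ | ⌊Q.1 + θ⌋₊ = i ∧ ⌊Q.2 + θ⌋₊ = j} ∩ Set.Ico 0 1 =
      Set.Ico (max (max (i - Q.1) (j - Q.2)) 0) (min (min (i + 1 - Q.1) (j + 1 - Q.2)) 1) := by
    ext θ
    simp only [Set.mem_inter_iff, Set.mem_ofPred_eq, Set.mem_Ico, max_le_iff, lt_min_iff]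
    constructor
    · rintro ⟨⟨ha, hb⟩, h0, h1'⟩
      rw [Nat.floor_eq_iff (by linarith)] at ha hb
      refine ⟨⟨⟨?_, ?_⟩, h0⟩, ⟨?_, ?_⟩, h1'⟩ <;> linarith
    · rintro ⟨⟨⟨ha, hb⟩, h0⟩, ⟨hc, hd⟩, h1'⟩
      rw [Nat.floor_eq_iff (by linarith), Nat.floor_eq_iff (by linarith)]
      refine ⟨⟨⟨?_, ?_⟩, ?_, ?_⟩, h0, h1'⟩ <;> linarith
  rw [measureReal_restrict_apply hm, hset, Real.volume_real_Ico, hatWeight, max_comm]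
  congr 1
  have e1 : max (max ((i : ℝ) - Q.1) (j - Q.2)) 0 = -min (min (Q.1 - i) (Q.2 - j)) 0 := by
    rw [← max_neg_neg, ← max_neg_neg, neg_sub, neg_sub, neg_zero]
  have e2 : min (min ((i : ℝ) + 1 - Q.1) (j + 1 - Q.2)) 1 =
      1 - max (max (Q.1 - i) (Q.2 - j)) 0 := by
    rw [← min_sub_sub_left, ← min_sub_sub_left]
    congr 1
    · congr 1 <;> ring
    · ring
  rw [e1, e2]
  ring

lemma natFloor_add_le {n : ℕ} {v θ : ℝ} (hv : v ≤ n) (hθ : θ < 1) : ⌊v + θ⌋₊ ≤ n := by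
  rcases lt_or_ge (v + θ) 0 with h | h
  · simp [Nat.floor_of_nonpos h.le]
  · exact Nat.lt_succ_iff.1 ((Nat.floor_lt h).2 (by push_cast; linarith))

/-- Averaging over a uniform shift `θ` before rounding down to a grid vertex is the same as
interpolating with the hat functions. -/
lemma integral_natFloor_add_eq_interpolation {n : ℕ} {Q : ℝ × ℝ} (hQ : Q ∈ constraintSet n)
    (F : ℕ → ℕ → ℝ) :
    IntegrableOn (fun θ : ℝ => F ⌊Q.1 + θ⌋₊ ⌊Q.2 + θ⌋₊) (Set.Ico 0 1) ∧
    ∫ θ in Set.Ico (0 : ℝ) 1, F ⌊Q.1 + θ⌋₊ ⌊Q.2 + θ⌋₊ =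
      ∑ i ∈ Finset.range (n + 1), ∑ j ∈ Finset.range (n + 1), hatWeight i j Q * F i j := by
  obtain ⟨h0, h1, h2⟩ := hQ
  let S : ℕ → ℕ → Set ℝ := fun i j => {θ | ⌊Q.1 + θ⌋₊ = i ∧ ⌊Q.2 + θ⌋₊ = j}
  have hm : ∀ i j, MeasurableSet (S i j) := fun i j =>
    (measurable_natFloor_add Q.1 (measurableSet_singleton i)).inter
      (measurable_natFloor_add Q.2 (measurableSet_singleton j))
  have hint : ∀ i j, IntegrableOn ((S i j).indicator fun _ => F i j) (Set.Ico (0 : ℝ) 1) :=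
    fun i j => (integrable_const _).indicator (hm i j)
  have hsum : Integrable (fun θ => ∑ i ∈ Finset.range (n + 1), ∑ j ∈ Finset.range (n + 1),
      (S i j).indicator (fun _ => F i j) θ) (volume.restrict (Set.Ico (0 : ℝ) 1)) :=
    integrable_finsetSum _ fun i _ => integrable_finsetSum _ fun j _ => hint i j
  have heq : (fun θ => ∑ i ∈ Finset.range (n + 1), ∑ j ∈ Finset.range (n + 1),
      (S i j).indicator (fun _ => F i j) θ) =ᵐ[volume.restrict (Set.Ico (0 : ℝ) 1)]
      fun θ => F ⌊Q.1 + θ⌋₊ ⌊Q.2 + θ⌋₊ := by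
    filter_upwards [ae_restrict_mem measurableSet_Ico] with θ hθ
    rw [Finset.sum_eq_single ⌊Q.1 + θ⌋₊, Finset.sum_eq_single ⌊Q.2 + θ⌋₊]
    · simp [S]
    · intro j _ hj
      simp [S, Ne.symm hj]
    · intro h
      exact absurd (Finset.mem_range.2 (Nat.lt_succ_of_le (natFloor_add_le h2 hθ.2))) h
    · intro i _ hi
      simp [S, Ne.symm hi]
    · intro h
      exact absurd (Finset.mem_range.2 (Nat.lt_succ_of_le
        (natFloor_add_le (h1.trans h2) hθ.2))) h
  refine ⟨hsum.congr heq, ?_⟩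
  rw [← integral_congr_ae heq, integral_finsetSum _ fun i _ => integrable_finsetSum _ fun j _ =>
    hint i j]
  refine Finset.sum_congr rfl fun i _ => ?_
  rw [integral_finsetSum _ fun j _ => hint i j]
  refine Finset.sum_congr rfl fun j _ => ?_
  rw [integral_indicator_const _ (hm i j), volume_real_floor_add_eq i j h0 (h0.trans h1),
    smul_eq_mul]

/-- Vertices `(i, j)` with `j < i` do not contribute to points above the diagonal. -/
lemma le_of_hatWeight_ne_zero {i j : ℕ} {Q : ℝ × ℝ} (h0 : 0 ≤ Q.1) (h1 : Q.1 ≤ Q.2)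
    (h : hatWeight i j Q ≠ 0) : i ≤ j := by
  rw [← volume_real_floor_add_eq i j h0 (h0.trans h1)] at h
  by_contra hij
  refine h ?_
  convert measureReal_empty
  refine Set.eq_empty_of_forall_notMem fun θ ⟨ha, hb⟩ => hij ?_
  rw [← ha, ← hb]
  exact Nat.floor_le_floor (by linarith)

lemma integral_natFloor_add {x : ℝ} (hx : 0 ≤ x) :
    ∫ θ in Set.Ico (0 : ℝ) 1, (⌊x + θ⌋₊ : ℝ) = x := by
  have h1 : ∫ θ in Set.Ico (0 : ℝ) 1, (⌊x + θ⌋₊ : ℝ) =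
      ∫ θ in (0 : ℝ)..1, (x + θ - Int.fract (x + θ)) := by
    rw [intervalIntegral.integral_of_le zero_le_one, ← integral_Ico_eq_integral_Ioc]
    refine setIntegral_congr_fun measurableSet_Ico fun θ hθ => ?_
    show (⌊x + θ⌋₊ : ℝ) = x + θ - Int.fract (x + θ)
    rw [Int.self_sub_fract, natCast_floor_eq_intCast_floor (add_nonneg hx hθ.1)]
  have hfi : ∀ a b : ℝ, IntervalIntegrable (fun θ : ℝ => Int.fract θ) volume a b := fun a b =>
    (intervalIntegrable_const (c := (1 : ℝ))).mono_fun measurable_fract.aestronglyMeasurable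
      (Filter.Eventually.of_forall fun θ => by
        simpa [abs_of_nonneg (Int.fract_nonneg θ)] using (Int.fract_lt_one θ).le)
  have h2 : ∫ θ in (0 : ℝ)..1, Int.fract (x + θ) = ∫ θ in (0 : ℝ)..1, θ := by
    rw [intervalIntegral.integral_comp_add_left (fun θ => Int.fract θ) x, add_zero,
      (Int.fract_periodic ℝ).intervalIntegral_add_eq x 0, zero_add,
      intervalIntegral.integral_of_le zero_le_one, intervalIntegral.integral_of_le zero_le_one,
      ← integral_Ico_eq_integral_Ioc, ← integral_Ico_eq_integral_Ioc]
    exact setIntegral_congr_fun measurableSet_Ico fun θ hθ => Int.fract_eq_self.2 hθ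
  have hc : IntervalIntegrable (fun θ : ℝ => Int.fract (x + θ)) volume 0 1 := by
    simpa using (hfi (x + 0) (x + 1)).comp_add_left x
  rw [h1, intervalIntegral.integral_sub (Continuous.intervalIntegrable (by fun_prop) _ _) hc, h2,
    intervalIntegral.integral_add (Continuous.intervalIntegrable (by fun_prop) _ _)
      (Continuous.intervalIntegrable (by fun_prop) _ _)]
  simp

lemma integrableOn_natFloor_add {x : ℝ} (hx : 0 ≤ x) :
    IntegrableOn (fun θ : ℝ => (⌊x + θ⌋₊ : ℝ)) (Set.Ico 0 1) :=
  (integral_natFloor_add_eq_interpolation (n := ⌈x⌉₊) (Q := (x, x)) ⟨hx, le_rfl, Nat.le_ceil x⟩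
    fun i _ => i).1

lemma sum_hatWeight {n : ℕ} {Q : ℝ × ℝ} (hQ : Q ∈ constraintSet n) :
    ∑ i ∈ Finset.range (n + 1), ∑ j ∈ Finset.range (n + 1), hatWeight i j Q = 1 := by
  simpa using (integral_natFloor_add_eq_interpolation hQ fun _ _ => 1).2.symm

lemma sum_hatWeight_mul_fst {n : ℕ} {Q : ℝ × ℝ} (hQ : Q ∈ constraintSet n) :
    ∑ i ∈ Finset.range (n + 1), ∑ j ∈ Finset.range (n + 1), hatWeight i j Q * i = Q.1 := by
  rw [← (integral_natFloor_add_eq_interpolation hQ fun i _ => i).2, integral_natFloor_add hQ.1]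

lemma sum_hatWeight_mul_snd {n : ℕ} {Q : ℝ × ℝ} (hQ : Q ∈ constraintSet n) :
    ∑ i ∈ Finset.range (n + 1), ∑ j ∈ Finset.range (n + 1), hatWeight i j Q * j = Q.2 := by
  rw [← (integral_natFloor_add_eq_interpolation hQ fun _ j => j).2,
    integral_natFloor_add (hQ.1.trans hQ.2.1)]

end

/-! ### Integer-valued controls with an exact number of exercise dates -/

section

variable {Ω : Type*}

/-- The total payoff `∑_{k < n} q_k V_k` of a control. -/
def payoff (n : ℕ) (V q : ℕ → Ω → ℝ) (ω : Ω) : ℝ := ∑ k ∈ Finset.range n, q k ω * V k ω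

lemma payoff_succ (n : ℕ) (V p : ℕ → Ω → ℝ) (ω : Ω) :
    payoff (n + 1) V p ω =
      p 0 ω * V 0 ω + payoff n (fun k => V (k + 1)) (fun k => p (k + 1)) ω := by
  rw [payoff, Finset.sum_range_succ', add_comm, payoff]

variable [mΩ : MeasurableSpace Ω]

/-- `p` is an adapted control which on the event `B` is `{0, 1}`-valued and has a number of
exercise dates lying in `[a, b]`. -/
structure IsBinaryControlOn (ℱ : Filtration ℕ mΩ) (n : ℕ) (a b : ℕ) (B : Set Ω)
    (p : ℕ → Ω → ℝ) : Prop where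
  measurable : ∀ k < n, Measurable[ℱ k] (p k)
  binary : ∀ k < n, ∀ ω ∈ B, p k ω = 0 ∨ p k ω = 1
  sum_mem : ∀ ω ∈ B, ∑ k ∈ Finset.range n, p k ω ∈ Set.Icc (a : ℝ) b

lemma integrable_payoff {μ : Measure Ω} {ℱ : Filtration ℕ mΩ} {n : ℕ} {V p : ℕ → Ω → ℝ}
    (hV : ∀ k < n, Integrable (V k) μ) (hp : ∀ k < n, Measurable[ℱ k] (p k))
    (hp' : ∀ k < n, ∀ ω, p k ω ∈ Set.Icc (0 : ℝ) 1) : Integrable (payoff n V p) μ := by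
  refine integrable_finsetSum _ fun k hk => ?_
  rw [Finset.mem_range] at hk
  refine (hV k hk).bdd_mul (c := 1) ((hp k hk).mono (ℱ.le k) le_rfl).aestronglyMeasurable
    (Filter.Eventually.of_forall fun ω => ?_)
  rw [Real.norm_of_nonneg (hp' k hk ω).1]
  exact (hp' k hk ω).2

lemma IsBinaryControlOn.mem_Icc {ℱ : Filtration ℕ mΩ} {n a b : ℕ} {p : ℕ → Ω → ℝ}
    (hp : IsBinaryControlOn ℱ n a b Set.univ p) : ∀ k < n, ∀ ω, p k ω ∈ Set.Icc (0 : ℝ) 1 := by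
  intro k hk ω
  rcases hp.binary k hk ω trivial with h | h <;> simp [h]

lemma IsBinaryControlOn.integrable_payoff {μ : Measure Ω} {ℱ : Filtration ℕ mΩ} {n a b : ℕ}
    {V p : ℕ → Ω → ℝ} (hp : IsBinaryControlOn ℱ n a b Set.univ p)
    (hV : ∀ k < n, Integrable (V k) μ) : Integrable (payoff n V p) μ :=
  Swing.integrable_payoff hV hp.measurable hp.mem_Icc

open Classical in
lemma IsBinaryControlOn.piecewise {ℱ : Filtration ℕ mΩ} {n a b : ℕ} {B : Set Ω}
    {p q : ℕ → Ω → ℝ} (hB : MeasurableSet[ℱ 0] B) (hp : IsBinaryControlOn ℱ n a b B p)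
    (hq : IsBinaryControlOn ℱ n a b Bᶜ q) :
    IsBinaryControlOn ℱ n a b Set.univ (fun k => B.piecewise (p k) (q k)) where
  measurable k hk :=
    Measurable.piecewise (ℱ.mono (Nat.zero_le k) _ hB) (hp.measurable k hk) (hq.measurable k hk)
  binary k hk ω _ := by
    by_cases h : ω ∈ B
    · simpa [h] using hp.binary k hk ω h
    · simpa [h] using hq.binary k hk ω h
  sum_mem ω _ := by
    by_cases h : ω ∈ B
    · simpa [h] using hp.sum_mem ω h
    · simpa [h] using hq.sum_mem ω h

lemma IsBinaryControlOn.mono {ℱ : Filtration ℕ mΩ} {n a b : ℕ} {B C : Set Ω}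
    {p : ℕ → Ω → ℝ} (hp : IsBinaryControlOn ℱ n a b C p) (h : B ⊆ C) :
    IsBinaryControlOn ℱ n a b B p :=
  ⟨hp.measurable, fun k hk ω hω => hp.binary k hk ω (h hω), fun ω hω => hp.sum_mem ω (h hω)⟩

/-- `q` maximizes the expected payoff among the `{0, 1}`-valued controls with a number of exercise
dates in `[a, b]`. -/
structure IsBinaryOptimal (μ : Measure Ω) (ℱ : Filtration ℕ mΩ) (n : ℕ) (V : ℕ → Ω → ℝ)
    (a b : ℕ) (q : ℕ → Ω → ℝ) : Prop where
  control : IsBinaryControlOn ℱ n a b Set.univ q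
  le : ∀ p, IsBinaryControlOn ℱ n a b Set.univ p → ∫ ω, payoff n V p ω ∂μ ≤ ∫ ω, payoff n V q ω ∂μ

/-- By pasting, an optimal control beats every competitor on each event known at time `0`. -/
lemma IsBinaryOptimal.setIntegral_le {μ : Measure Ω} {ℱ : Filtration ℕ mΩ} {n : ℕ}
    {V : ℕ → Ω → ℝ} (hV : ∀ k < n, Integrable (V k) μ) {a b : ℕ} {q : ℕ → Ω → ℝ}
    (hq : IsBinaryOptimal μ ℱ n V a b q) {B : Set Ω} (hB : MeasurableSet[ℱ 0] B)
    {p : ℕ → Ω → ℝ} (hp : IsBinaryControlOn ℱ n a b B p) :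
    IntegrableOn (payoff n V p) B μ ∧
      ∫ ω in B, payoff n V p ω ∂μ ≤ ∫ ω in B, payoff n V q ω ∂μ := by
  classical
  have hB' : MeasurableSet B := ℱ.le 0 _ hB
  have hr := IsBinaryControlOn.piecewise hB hp (hq.control.mono (Set.subset_univ _))
  set r : ℕ → Ω → ℝ := fun k => B.piecewise (p k) (q k)
  have h1 : Set.EqOn (payoff n V r) (payoff n V p) B := fun ω hω => by simp [payoff, r, hω]
  have h2 : Set.EqOn (payoff n V r) (payoff n V q) Bᶜ := fun ω hω => by
    simp [payoff, r, Set.notMem_of_mem_compl hω]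
  have hri := hr.integrable_payoff hV
  have hqi := hq.control.integrable_payoff hV
  refine ⟨hri.integrableOn.congr_fun h1 hB', ?_⟩
  have h := hq.le r hr
  rw [← integral_add_compl hB' hri, ← integral_add_compl hB' hqi, setIntegral_congr_fun hB' h1,
    setIntegral_congr_fun hB'.compl h2] at h
  linarith

lemma condExp_nonneg_of_forall_setIntegral_nonneg {μ : Measure Ω} [IsFiniteMeasure μ]
    {m : MeasurableSpace Ω} (hm : m ≤ mΩ) {X : Ω → ℝ} (hX : Integrable X μ)
    (h : ∀ B, MeasurableSet[m] B → 0 ≤ ∫ ω in B, X ω ∂μ) : 0 ≤ᵐ[μ] μ[X | m] := by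
  refine ae_le_of_ae_le_trim (hm := hm) (ae_nonneg_of_forall_setIntegral_nonneg
    (integrable_condExp.trim hm stronglyMeasurable_condExp) fun s hs _ => ?_)
  rw [← setIntegral_trim hm stronglyMeasurable_condExp hs, setIntegral_condExp hm hX hs]
  exact h s hs

/-- The filtration shifted by one unit of time. -/
def shiftFiltration (ℱ : Filtration ℕ mΩ) : Filtration ℕ mΩ where
  seq k := ℱ (k + 1)
  mono' _ _ h := ℱ.mono (Nat.succ_le_succ h)
  le' k := ℱ.le (k + 1)

/-- Concavity in the number of exercise dates: if the optimal controls are nested, then the value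
of one more exercise right decreases with the number of rights, because
`q_c + q_{c+2} - q_{c+1}` competes with `q_{c+1}`. -/
lemma setIntegral_concave_of_nested {μ : Measure Ω} {ℱ : Filtration ℕ mΩ} {n : ℕ}
    {V : ℕ → Ω → ℝ} (hV : ∀ k < n, Integrable (V k) μ) {c : ℕ} {q₀ q₁ q₂ : ℕ → Ω → ℝ}
    (h₀ : IsBinaryControlOn ℱ n c c Set.univ q₀) (h₁ : IsBinaryOptimal μ ℱ n V (c + 1) (c + 1) q₁)
    (h₂ : IsBinaryControlOn ℱ n (c + 2) (c + 2) Set.univ q₂)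
    (h₀₁ : ∀ k < n, ∀ ω, q₀ k ω ≤ q₁ k ω) (h₁₂ : ∀ k < n, ∀ ω, q₁ k ω ≤ q₂ k ω)
    {B : Set Ω} (hB : MeasurableSet[ℱ 0] B) :
    (∫ ω in B, payoff n V q₀ ω ∂μ) + ∫ ω in B, payoff n V q₂ ω ∂μ ≤
      2 * ∫ ω in B, payoff n V q₁ ω ∂μ := by
  have hp : IsBinaryControlOn ℱ n (c + 1) (c + 1) B (fun k ω => q₀ k ω + q₂ k ω - q₁ k ω) := by
    refine ⟨fun k hk => ((h₀.measurable k hk).add (h₂.measurable k hk)).sub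
      (h₁.control.measurable k hk), fun k hk ω _ => ?_, fun ω _ => ?_⟩
    · have a := h₀₁ k hk ω
      have b := h₁₂ k hk ω
      rcases h₀.binary k hk ω trivial with e | e <;>
      rcases h₁.control.binary k hk ω trivial with e' | e' <;>
      rcases h₂.binary k hk ω trivial with e'' | e'' <;>
      first
        | (exfalso; linarith)
        | simp [e, e', e'']
    · have a := h₀.sum_mem ω trivial
      have b := h₁.control.sum_mem ω trivial
      have d := h₂.sum_mem ω trivial
      rw [Finset.sum_sub_distrib, Finset.sum_add_distrib]
      push_cast [Set.mem_Icc] at *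
      constructor <;> linarith
  have h := (h₁.setIntegral_le hV hB hp).2
  have i₀ := (h₀.integrable_payoff hV).integrableOn (s := B)
  have i₁ := (h₁.control.integrable_payoff hV).integrableOn (s := B)
  have i₂ := (h₂.integrable_payoff hV).integrableOn (s := B)
  have e : payoff n V (fun k ω => q₀ k ω + q₂ k ω - q₁ k ω) =
      payoff n V q₀ + payoff n V q₂ - payoff n V q₁ := by
    ext ω
    simp only [payoff, Pi.add_apply, Pi.sub_apply, ← Finset.sum_add_distrib,
      ← Finset.sum_sub_distrib]
    exact Finset.sum_congr rfl fun k _ => by ring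
  rw [e, integral_sub' (i₀.add i₂) i₁, integral_add' i₀ i₂] at h
  linarith

lemma setIntegral_le_setIntegral_of_condExp_sign {μ : Measure Ω} [IsFiniteMeasure μ]
    {m : MeasurableSpace Ω} (hm : m ≤ mΩ) {X : Ω → ℝ} (hX : Integrable X μ) {D D' : Set Ω}
    (hD : MeasurableSet[m] D) (hD' : MeasurableSet[m] D')
    (h : ∀ᵐ ω ∂μ, ω ∈ D ↔ 0 ≤ (μ[X | m]) ω) :
    ∫ ω in D', X ω ∂μ ≤ ∫ ω in D, X ω ∂μ := by
  rw [← setIntegral_condExp hm hX hD, ← setIntegral_condExp hm hX hD',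
    ← integral_indicator (hm _ hD), ← integral_indicator (hm _ hD')]
  refine integral_mono_ae (integrable_condExp.indicator (hm _ hD'))
    (integrable_condExp.indicator (hm _ hD)) ?_
  filter_upwards [h] with ω hω
  by_cases h1 : ω ∈ D
  · have := hω.1 h1
    by_cases h2 : ω ∈ D' <;> simp [h1, h2, this]
  · have := lt_of_not_ge fun h => h1 (hω.2 h)
    by_cases h2 : ω ∈ D' <;> simp [h1, h2, this.le]

/-- For every number `c ≤ n` of exercise rights there is an optimal `{0, 1}`-valued control, and
these controls can be chosen nested in `c`. By backward induction: with `c` rights one exercises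
at time `0` if and only if the immediate payoff exceeds the conditional expected loss of value due
to giving up one right. This loss is decreasing in `c`, so the exercise regions increase. -/
theorem exists_nested_isBinaryOptimal {μ : Measure Ω} [IsFiniteMeasure μ] (n : ℕ) :
    ∀ (ℱ : Filtration ℕ mΩ) (V : ℕ → Ω → ℝ), (∀ k < n, Measurable[ℱ k] (V k)) →
      (∀ k < n, Integrable (V k) μ) →
      ∃ q : ℕ → ℕ → Ω → ℝ, (∀ c ≤ n, IsBinaryOptimal μ ℱ n V c c (q c)) ∧
        ∀ c < n, ∀ k < n, ∀ ω, q c k ω ≤ q (c + 1) k ω := by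
  classical
  induction n with
  | zero =>
    refine fun ℱ V _ _ => ⟨0, fun c hc => ?_, by simp⟩
    obtain rfl : c = 0 := by omega
    exact ⟨⟨by simp, by simp, by simp⟩, fun p _ => by simp [payoff]⟩
  | succ n ih =>
    intro ℱ V hVm hVi
    have hWi : ∀ k < n, Integrable (V (k + 1)) μ := fun k hk => hVi _ (by omega)
    obtain ⟨q, hq, hnest⟩ := ih (shiftFiltration ℱ) (fun k => V (k + 1))
      (fun k hk => hVm _ (by omega)) hWi
    set W : ℕ → Ω → ℝ := fun k => V (k + 1)
    -- an extension of the family of optimal controls to all numbers of rights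
    set r : ℕ → ℕ → Ω → ℝ := fun c => q (min c n)
    have hr : ∀ c, IsBinaryOptimal μ (shiftFiltration ℱ) n W (min c n) (min c n) (r c) :=
      fun c => hq _ (min_le_right _ _)
    have hrnest : ∀ c, ∀ k < n, ∀ ω, r c k ω ≤ r (c + 1) k ω := fun c k hk ω => by
      rcases lt_or_ge c n with h | h
      · simpa [r, min_eq_left h.le, min_eq_left (Nat.succ_le_of_lt h)] using hnest c h k hk ω
      · simp [r, min_eq_right h, min_eq_right (h.trans (Nat.le_succ c))]
    have hRi : ∀ c, Integrable (payoff n W (r c)) μ := fun c => (hr c).control.integrable_payoff hWi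
    have hV0 : Integrable (V 0) μ := hVi 0 (Nat.succ_pos n)
    have h01 : ∀ {B : Set Ω}, MeasurableSet[ℱ 0] B → MeasurableSet[shiftFiltration ℱ 0] B :=
      fun hB => ℱ.mono (Nat.zero_le 1) _ hB
    -- the gain from exercising one of `c + 1` rights at time `0`
    set Y : ℕ → Ω → ℝ := fun c => V 0 + payoff n W (r c) - payoff n W (r (c + 1))
    have hYi : ∀ c, Integrable (Y c) μ := fun c => (hV0.add (hRi c)).sub (hRi (c + 1))
    have hEmono : ∀ c, c + 1 < n → μ[Y c | ℱ 0] ≤ᵐ[μ] μ[Y (c + 1) | ℱ 0] := fun c hc => by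
      have h1 : 0 ≤ᵐ[μ] μ[Y (c + 1) - Y c | ℱ 0] := by
        refine condExp_nonneg_of_forall_setIntegral_nonneg (ℱ.le 0) ((hYi _).sub (hYi _))
          fun B hB => ?_
        have hc0 := hr c
        have hc1 := hr (c + 1)
        have hc2 := hr (c + 1 + 1)
        rw [min_eq_left (by omega)] at hc0 hc1 hc2
        have := setIntegral_concave_of_nested hWi hc0.control hc1 hc2.control (hrnest c)
          (hrnest (c + 1)) (h01 hB)
        have e : Y (c + 1) - Y c = (fun ω => 2 * payoff n W (r (c + 1)) ω) -
            (payoff n W (r c) + payoff n W (r (c + 1 + 1))) := by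
          ext ω
          simp only [Y, Pi.sub_apply, Pi.add_apply]
          ring
        rw [e, integral_sub' ((hRi _).const_mul 2).integrableOn ((hRi _).add (hRi _)).integrableOn,
          integral_const_mul, integral_add' (hRi _).integrableOn (hRi _).integrableOn]
        linarith
      filter_upwards [h1, condExp_sub (hYi (c + 1)) (hYi c) (ℱ 0)] with ω h h'
      rw [h'] at h
      simpa using h
    -- the exercise regions at time `0` (unions over `c' < c`, so that they
    -- increase in `c` everywhere and not only almost surely)
    set D : ℕ → Set Ω := fun c => {ω | n < c ∨ ∃ c' < c, 0 ≤ (μ[Y c' | ℱ 0]) ω}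
    have hD0 : D 0 = ∅ := by ext; simp [D]
    have hDtop : ∀ c, n < c → D c = Set.univ := fun c hc => by ext; simp [D, hc]
    have hDle : ∀ c ω, ω ∉ D c → c ≤ n := fun c ω h => not_lt.1 fun h' => h (Or.inl h')
    have hDm : ∀ c, MeasurableSet[ℱ 0] (D c) := fun c => by
      have : D c = {ω | n < c} ∪ ⋃ c' ∈ Set.Iio c, {ω | 0 ≤ (μ[Y c' | ℱ 0]) ω} := by
        ext ω; simp [D]
      rw [this]
      refine (MeasurableSet.const _).union
        (MeasurableSet.biUnion (Set.to_countable _) fun c' _ => ?_)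
      exact measurableSet_le measurable_const stronglyMeasurable_condExp.measurable
    have hDmono : ∀ c, D c ⊆ D (c + 1) := fun c ω h => by
      rcases h with h | ⟨c', h, h'⟩
      · exact Or.inl (by omega)
      · exact Or.inr ⟨c', by omega, h'⟩
    have hDiff : ∀ c < n, ∀ᵐ ω ∂μ, ω ∈ D (c + 1) ↔ 0 ≤ (μ[Y c | ℱ 0]) ω := fun c hc => by
      have h : ∀ᵐ ω ∂μ, ∀ c', c' + 1 < n → (μ[Y c' | ℱ 0]) ω ≤ (μ[Y (c' + 1) | ℱ 0]) ω :=
        ae_all_iff.2 fun c' => by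
          by_cases h : c' + 1 < n
          · filter_upwards [hEmono c' h] with ω hω _ using hω
          · exact Filter.Eventually.of_forall fun ω h' => absurd h' h
      filter_upwards [h] with ω hω
      constructor
      · rintro (h | ⟨c', h, h'⟩)
        · omega
        · have : ∀ d, c' + d < n → (μ[Y c' | ℱ 0]) ω ≤ (μ[Y (c' + d) | ℱ 0]) ω := by
            intro d
            induction d with
            | zero => intro _; exact le_rfl
            | succ d ihd => intro hd; exact (ihd (by omega)).trans (hω _ hd)
          have h2 := this (c - c') (by omega)
          rw [show c' + (c - c') = c by omega] at h2
          exact h'.trans h2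
      · exact fun h => Or.inr ⟨c, Nat.lt_succ_self c, h⟩
    -- on `D c` exercise and continue with `c - 1` rights, otherwise continue with `c` rights
    let p : ℕ → ℕ → Ω → ℝ := fun c k => Nat.casesOn k ((D c).indicator 1)
      fun j => (D c).piecewise (r (c - 1) j) (r c j)
    have hp0 : ∀ c, p c 0 = (D c).indicator 1 := fun c => rfl
    have hps : ∀ c j, p c (j + 1) = (D c).piecewise (r (c - 1) j) (r c j) := fun c j => rfl
    have hDpos : ∀ c ω, ω ∈ D c → c ≠ 0 := fun c ω h h' => by simp [h', hD0] at h
    have hp : ∀ c ≤ n + 1, IsBinaryControlOn ℱ (n + 1) c c Set.univ (p c) := by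
      refine fun c hc => ⟨?_, ?_, ?_⟩
      · intro k hk
        rcases k with _ | j
        · rw [hp0]
          exact Measurable.indicator measurable_const (hDm c)
        · rw [hps]
          exact Measurable.piecewise (ℱ.mono (Nat.zero_le _) _ (hDm c))
            ((hr (c - 1)).control.measurable j (by omega)) ((hr c).control.measurable j (by omega))
      · intro k hk ω _
        rcases k with _ | j
        · rw [hp0]
          by_cases h : ω ∈ D c <;> simp [h]
        · rw [hps]
          by_cases h : ω ∈ D c
          · simpa [h] using (hr (c - 1)).control.binary j (by omega) ω trivial
          · simpa [h] using (hr c).control.binary j (by omega) ω trivial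
      · intro ω _
        rw [Finset.sum_range_succ', hp0]
        simp_rw [hps]
        by_cases h : ω ∈ D c
        · have h1 := (hr (c - 1)).control.sum_mem ω trivial
          have h2 := hDpos c ω h
          rw [min_eq_left (by omega), Nat.cast_sub (by omega)] at h1
          simp only [h, Set.piecewise_eq_of_mem, Set.indicator_of_mem, Pi.one_apply, Set.mem_Icc,
            Nat.cast_one] at h1 ⊢
          constructor <;> linarith
        · have h1 := (hr c).control.sum_mem ω trivial
          rw [min_eq_left (hDle c ω h)] at h1
          simpa [h] using h1
    refine ⟨p, fun c hc => ⟨hp c hc, ?_⟩, ?_⟩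
    · intro p' hp'
      set D' : Set Ω := {ω | p' 0 ω = 1}
      have hD'm : MeasurableSet[ℱ 0] D' :=
        hp'.measurable 0 (Nat.succ_pos n) (measurableSet_singleton 1)
      have hp'0 : ∀ ω ∉ D', p' 0 ω = 0 := fun ω h =>
        (hp'.binary 0 (Nat.succ_pos n) ω trivial).resolve_right h
      have hsum : ∀ ω, ∑ k ∈ Finset.range n, p' (k + 1) ω + p' 0 ω = c := fun ω => by
        rw [← Finset.sum_range_succ' fun k => p' k ω]
        exact le_antisymm (hp'.sum_mem ω trivial).2 (hp'.sum_mem ω trivial).1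
      have hsum0 : ∀ ω, 0 ≤ ∑ k ∈ Finset.range n, p' (k + 1) ω := fun ω =>
        Finset.sum_nonneg fun k hk => (hp'.mem_Icc _ (by simpa using hk) ω).1
      have hsumn : ∀ ω, ∑ k ∈ Finset.range n, p' (k + 1) ω ≤ n := fun ω => by
        refine (Finset.sum_le_card_nsmul _ _ 1 fun k hk =>
          (hp'.mem_Icc _ (by simpa using hk) ω).2).trans (by simp)
      have hD'pos : ∀ ω ∈ D', c ≠ 0 := fun ω (hω : p' 0 ω = 1) h => by
        have := hsum ω
        rw [hω, h] at this
        push_cast at this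
        linarith [hsum0 ω]
      have hD'le : ∀ ω ∉ D', c ≤ n := fun ω hω => by
        have := hsum ω
        rw [hp'0 ω hω] at this
        exact_mod_cast (by linarith [hsumn ω] : (c : ℝ) ≤ n)
      set p'' : ℕ → Ω → ℝ := fun k => p' (k + 1)
      have c1 : IsBinaryControlOn (shiftFiltration ℱ) n (min (c - 1) n) (min (c - 1) n) D' p'' :=
        ⟨fun k hk => hp'.measurable (k + 1) (by omega),
          fun k hk ω _ => hp'.binary (k + 1) (by omega) ω trivial, fun ω hω => by
            have := hsum ω
            have h0 := hD'pos ω hω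
            have h1 : p' 0 ω = 1 := hω
            rw [min_eq_left (by omega), Nat.cast_sub (by omega), Nat.cast_one, Set.mem_Icc]
            constructor <;> linarith⟩
      have c2 : IsBinaryControlOn (shiftFiltration ℱ) n (min c n) (min c n) D'ᶜ p'' :=
        ⟨fun k hk => hp'.measurable (k + 1) (by omega),
          fun k hk ω _ => hp'.binary (k + 1) (by omega) ω trivial, fun ω hω => by
            have := hsum ω
            have h1 := hp'0 ω hω
            rw [min_eq_left (hD'le ω hω), Set.mem_Icc]
            constructor <;> linarith⟩
      obtain ⟨i1, l1⟩ := (hr (c - 1)).setIntegral_le hWi (h01 hD'm) c1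
      obtain ⟨i2, l2⟩ := (hr c).setIntegral_le hWi (h01 hD'm.compl) c2
      have hm := ℱ.le 0
      -- the expected payoff of exercising on `B` at time `0` and continuing optimally
      have key : ∀ B : Set Ω, MeasurableSet[ℱ 0] B →
          (∫ ω in B, V 0 ω ∂μ) + (∫ ω in B, payoff n W (r (c - 1)) ω ∂μ) +
            ∫ ω in Bᶜ, payoff n W (r c) ω ∂μ =
          (∫ ω, payoff n W (r c) ω ∂μ) +
            ∫ ω in B, (V 0 + payoff n W (r (c - 1)) - payoff n W (r c)) ω ∂μ := fun B hB => by
        rw [← integral_add_compl (hm _ hB) (hRi c)]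
        rw [integral_sub' (hV0.add (hRi _)).integrableOn (hRi c).integrableOn,
          integral_add' hV0.integrableOn (hRi _).integrableOn]
        ring
      have hle : ∫ ω, payoff (n + 1) V p' ω ∂μ ≤ (∫ ω in D', V 0 ω ∂μ) +
          (∫ ω in D', payoff n W (r (c - 1)) ω ∂μ) + ∫ ω in D'ᶜ, payoff n W (r c) ω ∂μ := by
        rw [← integral_add_compl (hm _ hD'm) (hp'.integrable_payoff hVi)]
        have e1 : ∫ ω in D', payoff (n + 1) V p' ω ∂μ =
            ∫ ω in D', (V 0 ω + payoff n W p'' ω) ∂μ :=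
          setIntegral_congr_fun (hm _ hD'm) fun ω (hω : p' 0 ω = 1) => by
            simp only [payoff_succ, hω, one_mul, W, p'']
        have e2 : ∫ ω in D'ᶜ, payoff (n + 1) V p' ω ∂μ = ∫ ω in D'ᶜ, payoff n W p'' ω ∂μ :=
          setIntegral_congr_fun (hm _ hD'm).compl fun ω hω => by
            simp only [payoff_succ, hp'0 ω hω, zero_mul, zero_add, W, p'']
        rw [e1, e2, integral_add hV0.integrableOn i1]
        linarith
      have hDp := (hp c hc).integrable_payoff hVi
      have heq : ∫ ω, payoff (n + 1) V (p c) ω ∂μ = (∫ ω in D c, V 0 ω ∂μ) +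
          (∫ ω in D c, payoff n W (r (c - 1)) ω ∂μ) + ∫ ω in (D c)ᶜ, payoff n W (r c) ω ∂μ := by
        rw [← integral_add_compl (hm _ (hDm c)) hDp]
        have e1 : ∫ ω in D c, payoff (n + 1) V (p c) ω ∂μ =
            ∫ ω in D c, (V 0 ω + payoff n W (r (c - 1)) ω) ∂μ :=
          setIntegral_congr_fun (hm _ (hDm c)) fun ω hω => by
            simp only [payoff_succ, hp0, hps]
            simp [payoff, hω, W]
        have e2 : ∫ ω in (D c)ᶜ, payoff (n + 1) V (p c) ω ∂μ =
            ∫ ω in (D c)ᶜ, payoff n W (r c) ω ∂μ :=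
          setIntegral_congr_fun (hm _ (hDm c)).compl fun ω hω => by
            have hω' : ω ∉ D c := hω
            simp only [payoff_succ, hp0, hps]
            simp [payoff, hω', W]
        rw [e1, e2, integral_add hV0.integrableOn (hRi _).integrableOn]
      refine hle.trans ?_
      rw [heq, key D' hD'm, key (D c) (hDm c)]
      refine add_le_add le_rfl ?_
      rcases c with _ | c
      · have : D' = D 0 := by
          rw [hD0]
          exact Set.eq_empty_of_forall_notMem fun ω hω => hD'pos ω hω rfl
        rw [this]
      · rcases lt_or_ge c n with h | h
        · exact setIntegral_le_setIntegral_of_condExp_sign hm (hYi c) (hDm _) hD'm (hDiff c h)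
        · have : D' = D (c + 1) := by
            rw [hDtop _ (by omega)]
            exact Set.eq_univ_of_forall fun ω => by_contra fun hω => by
              have := hD'le ω hω
              omega
          rw [this]
    · intro c hc k hk ω
      rcases k with _ | j
      · rw [hp0, hp0]
        exact Set.indicator_le_indicator_of_subset (hDmono c) (fun _ => zero_le_one) ω
      · rw [hps, hps]
        by_cases h : ω ∈ D c
        · have h' := hDmono c h
          have := hDpos c ω h
          have h2 := hrnest (c - 1) j (by omega) ω
          rw [Nat.sub_add_cancel (by omega)] at h2
          simpa [h, h'] using h2
        · by_cases h' : ω ∈ D (c + 1)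
          · simp [h, h']
          · simpa [h, h'] using hrnest c j (by omega) ω

end

/-! ### Integer bounds on the number of exercise dates -/

section

variable {Ω : Type*}

/-- The mixture of integer controls with the barycentric weights of `Q`. -/
noncomputable def mixedControl (n : ℕ) (r : ℕ → ℕ → ℕ → Ω → ℝ) (Q : ℝ × ℝ) (k : ℕ) (ω : Ω) : ℝ :=
  ∑ i ∈ Finset.range (n + 1), ∑ j ∈ Finset.range (n + 1), hatWeight i j Q * r i j k ω

lemma payoff_mixedControl (n : ℕ) (V : ℕ → Ω → ℝ) (r : ℕ → ℕ → ℕ → Ω → ℝ) (Q : ℝ × ℝ) (ω : Ω) :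
    payoff n V (mixedControl n r Q) ω = ∑ i ∈ Finset.range (n + 1), ∑ j ∈ Finset.range (n + 1),
      hatWeight i j Q * payoff n V (r i j) ω := by
  simp only [payoff, mixedControl, Finset.sum_mul, Finset.mul_sum]
  rw [Finset.sum_comm]
  refine Finset.sum_congr rfl fun i _ => ?_
  rw [Finset.sum_comm]
  exact Finset.sum_congr rfl fun j _ => Finset.sum_congr rfl fun k _ => by ring

variable [mΩ : MeasurableSpace Ω]

/-- If the bounds `a ≤ b` on the number of exercise dates are integers, there is an optimal
`{0, 1}`-valued control. After adding `b - a` periods with zero payoff, the constraint becomes an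
exact number `b` of exercise dates. -/
theorem exists_isBinaryOptimal {μ : Measure Ω} [IsFiniteMeasure μ] {n : ℕ} {ℱ : Filtration ℕ mΩ}
    {V : ℕ → Ω → ℝ} (hVm : ∀ k < n, Measurable[ℱ k] (V k)) (hVi : ∀ k < n, Integrable (V k) μ)
    {a b : ℕ} (hab : a ≤ b) (hbn : b ≤ n) : ∃ q, IsBinaryOptimal μ ℱ n V a b q := by
  classical
  set V' : ℕ → Ω → ℝ := fun k => if k < n then V k else 0
  obtain ⟨q, hq, -⟩ := exists_nested_isBinaryOptimal (μ := μ) (n + (b - a)) ℱ V'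
    (fun k _ => by
      by_cases h : k < n
      · simpa [V', h] using hVm k h
      · simp only [V', h, if_false]
        exact measurable_const)
    (fun k _ => by
      by_cases h : k < n
      · simpa [V', h] using hVi k h
      · simp [V', h])
  have hqb := hq b (by omega)
  have hpay : ∀ p : ℕ → Ω → ℝ, payoff (n + (b - a)) V' p = payoff n V p := fun p => by
    ext ω
    rw [payoff, Finset.sum_range_add, payoff]
    have h1 : ∑ k ∈ Finset.range n, p k ω * V' k ω = ∑ k ∈ Finset.range n, p k ω * V k ω :=
      Finset.sum_congr rfl fun k hk => by simp [V', Finset.mem_range.1 hk]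
    rw [h1]
    simp [V']
  have hcast : ((b - a : ℕ) : ℝ) = b - a := Nat.cast_sub hab
  refine ⟨q b, ⟨fun k hk => hqb.control.measurable k (by omega),
    fun k hk ω _ => hqb.control.binary k (by omega) ω trivial, fun ω _ => ?_⟩, fun p hp => ?_⟩
  · have h := hqb.control.sum_mem ω trivial
    rw [Finset.sum_range_add, Set.mem_Icc] at h
    have h0 : 0 ≤ ∑ l ∈ Finset.range (b - a), q b (n + l) ω := Finset.sum_nonneg fun l hl =>
      (hqb.control.mem_Icc _ (by have := Finset.mem_range.1 hl; omega) ω).1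
    have h1 : ∑ l ∈ Finset.range (b - a), q b (n + l) ω ≤ (b - a : ℕ) :=
      (Finset.sum_le_card_nsmul _ _ 1 fun l hl =>
        (hqb.control.mem_Icc _ (by have := Finset.mem_range.1 hl; omega) ω).2).trans (by simp)
    rw [hcast] at h1
    constructor <;> linarith [h.1, h.2]
  · -- the rights left after time `n` are exercised as early as possible in the added periods
    set p' : ℕ → Ω → ℝ := fun k ω => if k < n then p k ω else
      if ((k - n : ℕ) : ℝ) < b - ∑ j ∈ Finset.range n, p j ω then 1 else 0
    have hp'1 : ∀ k < n, p' k = p k := fun k hk => by ext ω; simp [p', hk]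
    have hctl : IsBinaryControlOn ℱ (n + (b - a)) b b Set.univ p' := by
      refine ⟨fun k _ => ?_, fun k _ ω _ => ?_, fun ω _ => ?_⟩
      · by_cases h : k < n
        · rw [hp'1 k h]
          exact hp.measurable k h
        · have : p' k = fun ω =>
              if ((k - n : ℕ) : ℝ) < b - ∑ j ∈ Finset.range n, p j ω then 1 else 0 := by
            ext ω; simp [p', h]
          rw [this]
          refine Measurable.ite (measurableSet_lt measurable_const (measurable_const.sub ?_))
            measurable_const measurable_const
          refine Finset.measurable_fun_sum _ fun j hj => ?_
          have := Finset.mem_range.1 hj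
          exact (hp.measurable j this).mono (ℱ.mono (by omega)) le_rfl
      · by_cases h : k < n
        · rw [hp'1 k h]
          exact hp.binary k h ω trivial
        · simp only [p', h, if_false]
          split_ifs <;> simp
      · obtain ⟨s, hs⟩ : ∃ s : ℕ, ∑ j ∈ Finset.range n, p j ω = s := by
          -- the number of exercise dates of `p`
          refine ⟨((Finset.range n).filter fun j => p j ω = 1).card, ?_⟩
          rw [← Finset.sum_boole]
          refine Finset.sum_congr rfl fun j hj => ?_
          rcases hp.binary j (Finset.mem_range.1 hj) ω trivial with h | h <;> simp [h]
        have hsab := hp.sum_mem ω trivial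
        rw [hs, Set.mem_Icc] at hsab
        have hsa : a ≤ s := by exact_mod_cast hsab.1
        have hsb : s ≤ b := by exact_mod_cast hsab.2
        have h1 : ∑ k ∈ Finset.range n, p' k ω = s := by
          rw [← hs]
          exact Finset.sum_congr rfl fun k hk => by rw [hp'1 k (Finset.mem_range.1 hk)]
        have h2 : ∑ l ∈ Finset.range (b - a), p' (n + l) ω = (b - s : ℕ) := by
          have : ∀ l, p' (n + l) ω = if l < b - s then 1 else 0 := fun l => by
            have : ((l : ℝ) < b - s) ↔ l < b - s := by
              rw [← Nat.cast_sub hsb, Nat.cast_lt]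
            simp only [p', add_lt_iff_neg_left, not_lt_zero, if_false, Nat.add_sub_cancel_left,
              hs, this]
          simp_rw [this]
          rw [Finset.sum_boole]
          congr 1
          have : (Finset.range (b - a)).filter (fun l => l < b - s) = Finset.range (b - s) := by
            ext l
            simp only [Finset.mem_filter, Finset.mem_range]
            omega
          rw [this, Finset.card_range]
        rw [Finset.sum_range_add, h1, h2, Nat.cast_sub hsb]
        constructor <;> linarith
    have h := hqb.le p' hctl
    rw [hpay, hpay] at h
    have : payoff n V p' = payoff n V p := by
      ext ω
      exact Finset.sum_congr rfl fun k hk => by rw [hp'1 k (Finset.mem_range.1 hk)]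
    rwa [this] at h

lemma exists_family_isBinaryOptimal {μ : Measure Ω} [IsFiniteMeasure μ] {n : ℕ}
    {ℱ : Filtration ℕ mΩ} {V : ℕ → Ω → ℝ} (hVm : ∀ k < n, Measurable[ℱ k] (V k))
    (hVi : ∀ k < n, Integrable (V k) μ) : ∃ r : ℕ → ℕ → ℕ → Ω → ℝ,
      ∀ i j, i ≤ j → j ≤ n → IsBinaryOptimal μ ℱ n V i j (r i j) := by
  have hex : ∀ i j, ∃ q', i ≤ j → j ≤ n → IsBinaryOptimal μ ℱ n V i j q' := fun i j => by
    by_cases h : i ≤ j ∧ j ≤ n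
    · obtain ⟨q', hq'⟩ := exists_isBinaryOptimal hVm hVi h.1 h.2
      exact ⟨q', fun _ _ => hq'⟩
    · exact ⟨0, fun h1 h2 => absurd ⟨h1, h2⟩ h⟩
  choose r hr using hex
  exact ⟨r, hr⟩

/-! ### Rounding of controls -/

/-- The `{0, 1}`-valued control obtained by rounding down the cumulative quantities shifted by
`θ`. It only uses the past of `q`, hence is adapted. -/
noncomputable def roundedControl (q : ℕ → Ω → ℝ) (θ : ℝ) (k : ℕ) (ω : Ω) : ℝ :=
  (⌊∑ j ∈ Finset.range (k + 1), q j ω + θ⌋₊ : ℝ) - ⌊∑ j ∈ Finset.range k, q j ω + θ⌋₊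

lemma natFloor_sub_natFloor_eq {x y : ℝ} (h : x ≤ y) (h' : y ≤ x + 1) :
    (⌊y⌋₊ : ℝ) - ⌊x⌋₊ = 0 ∨ (⌊y⌋₊ : ℝ) - ⌊x⌋₊ = 1 := by
  have h1 : ⌊x⌋₊ ≤ ⌊y⌋₊ := Nat.floor_le_floor h
  have h2 : ⌊y⌋₊ ≤ ⌊x⌋₊ + 1 := by
    rcases le_or_gt 0 x with hx | hx
    · rw [← Nat.floor_add_one hx]
      exact Nat.floor_le_floor h'
    · have : ⌊y⌋₊ < 1 := (Nat.floor_lt' one_ne_zero).2 (by push_cast; linarith)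
      omega
  obtain h | h : ⌊y⌋₊ = ⌊x⌋₊ ∨ ⌊y⌋₊ = ⌊x⌋₊ + 1 := by omega
  · left; rw [h]; ring
  · right; rw [h]; push_cast; ring

lemma roundedControl_binary {ℱ : Filtration ℕ mΩ} {n : ℕ} {Q : ℝ × ℝ} {q : ℕ → Ω → ℝ}
    (hq : IsAdmissible ℱ n Q q) (θ : ℝ) {k : ℕ} (hk : k < n) (ω : Ω) :
    roundedControl q θ k ω = 0 ∨ roundedControl q θ k ω = 1 := by
  have := hq.2.1 k hk ω
  refine natFloor_sub_natFloor_eq ?_ ?_ <;> rw [Finset.sum_range_succ] <;>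
    linarith [this.1, this.2]

lemma isBinaryControlOn_roundedControl {ℱ : Filtration ℕ mΩ} {n : ℕ} {Q : ℝ × ℝ} {q : ℕ → Ω → ℝ}
    (hq : IsAdmissible ℱ n Q q) {θ : ℝ} (hθ : θ < 1) :
    IsBinaryControlOn ℱ n ⌊Q.1 + θ⌋₊ ⌊Q.2 + θ⌋₊ Set.univ (roundedControl q θ) := by
  refine ⟨fun k hk => ?_, fun k hk ω _ => roundedControl_binary hq θ hk ω, fun ω _ => ?_⟩
  · have h : ∀ l ≤ k + 1, Measurable[ℱ k] fun ω => (⌊∑ j ∈ Finset.range l, q j ω + θ⌋₊ : ℝ) := by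
      refine fun l hl => (measurable_from_nat (f := ((↑) : ℕ → ℝ))).comp
        (Nat.measurable_floor.comp (Measurable.add_const ?_ θ))
      refine Finset.measurable_fun_sum _ fun j hj => ?_
      have := Finset.mem_range.1 hj
      exact (hq.1 j (by omega)).mono (ℱ.mono (by omega)) le_rfl
    exact (h (k + 1) le_rfl).sub (h k (Nat.le_succ k))
  · have h := hq.2.2 ω
    have h0 : ⌊θ⌋₊ = 0 := Nat.floor_eq_zero.2 hθ
    simp only [roundedControl]
    rw [Finset.sum_range_sub fun k => (⌊∑ j ∈ Finset.range k, q j ω + θ⌋₊ : ℝ)]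
    simp only [Finset.sum_range_zero, zero_add, h0, Nat.cast_zero, sub_zero, Set.mem_Icc,
      Nat.cast_le]
    exact ⟨Nat.floor_le_floor (by linarith [h.1]), Nat.floor_le_floor (by linarith [h.2])⟩

lemma integrable_payoff_roundedControl {μ : Measure Ω} [IsFiniteMeasure μ]
    {ℱ : Filtration ℕ mΩ} {n : ℕ} {Q : ℝ × ℝ} {V q : ℕ → Ω → ℝ}
    (hVi : ∀ k < n, Integrable (V k) μ) (hq : IsAdmissible ℱ n Q q) (B : Set Ω) :
    Integrable (Function.uncurry fun θ : ℝ => payoff n V (roundedControl q θ))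
      ((volume.restrict (Set.Ico (0 : ℝ) 1)).prod (μ.restrict B)) := by
  have hm : ∀ l ≤ n, Measurable fun x : ℝ × Ω =>
      (⌊∑ j ∈ Finset.range l, q j x.2 + x.1⌋₊ : ℝ) := fun l hl => by
    refine (measurable_from_nat (f := ((↑) : ℕ → ℝ))).comp
      (Nat.measurable_floor.comp (Measurable.add ?_ measurable_fst))
    refine Finset.measurable_fun_sum _ fun j hj => ?_
    have := Finset.mem_range.1 hj
    exact ((hq.1 j (by omega)).mono (ℱ.le j) le_rfl).comp measurable_snd
  have : (Function.uncurry fun θ : ℝ => payoff n V (roundedControl q θ)) =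
      fun x : ℝ × Ω => ∑ k ∈ Finset.range n, roundedControl q x.1 k x.2 * V k x.2 := rfl
  rw [this]
  refine integrable_finsetSum _ fun k hk => ?_
  rw [Finset.mem_range] at hk
  refine Integrable.bdd_mul (c := 1) ((hVi k hk).integrableOn.comp_snd _)
    ((hm (k + 1) hk).sub (hm k hk.le)).aestronglyMeasurable
    (Filter.Eventually.of_forall fun x => ?_)
  rcases roundedControl_binary hq x.1 hk x.2 with h | h <;> simp [h]

/-- A control is the average of its roundings. -/
lemma integral_payoff_roundedControl {ℱ : Filtration ℕ mΩ} {n : ℕ} {Q : ℝ × ℝ}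
    {q : ℕ → Ω → ℝ} (V : ℕ → Ω → ℝ) (hq : IsAdmissible ℱ n Q q) (ω : Ω) :
    ∫ θ in Set.Ico (0 : ℝ) 1, payoff n V (roundedControl q θ) ω = payoff n V q ω := by
  have h0 : ∀ l ≤ n, 0 ≤ ∑ j ∈ Finset.range l, q j ω := fun l hl =>
    Finset.sum_nonneg fun j hj => (hq.2.1 j (by have := Finset.mem_range.1 hj; omega) ω).1
  have hi : ∀ l ≤ n, IntegrableOn (fun θ : ℝ => (⌊∑ j ∈ Finset.range l, q j ω + θ⌋₊ : ℝ))
      (Set.Ico 0 1) := fun l hl => integrableOn_natFloor_add (h0 l hl)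
  simp only [payoff, roundedControl]
  rw [integral_finsetSum _ fun k hk => ?_]
  · refine Finset.sum_congr rfl fun k hk => ?_
    rw [Finset.mem_range] at hk
    rw [integral_mul_const, integral_sub (hi _ hk) (hi _ hk.le),
      integral_natFloor_add (h0 _ hk), integral_natFloor_add (h0 _ hk.le),
      Finset.sum_range_succ, add_sub_cancel_left]
  · rw [Finset.mem_range] at hk
    exact ((hi _ hk).sub (hi _ hk.le)).mul_const _

/-- On events known at time `0`, no admissible control beats the interpolation of the optimal
values at the integer constraints. -/
theorem setIntegral_payoff_le {μ : Measure Ω} [IsFiniteMeasure μ] {ℱ : Filtration ℕ mΩ} {n : ℕ}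
    {V : ℕ → Ω → ℝ} (hVi : ∀ k < n, Integrable (V k) μ) {r : ℕ → ℕ → ℕ → Ω → ℝ}
    (hr : ∀ i j, i ≤ j → j ≤ n → IsBinaryOptimal μ ℱ n V i j (r i j)) {Q : ℝ × ℝ}
    (hQ : Q ∈ constraintSet n) {q : ℕ → Ω → ℝ} (hq : IsAdmissible ℱ n Q q) {B : Set Ω}
    (hB : MeasurableSet[ℱ 0] B) :
    ∫ ω in B, payoff n V q ω ∂μ ≤ ∑ i ∈ Finset.range (n + 1), ∑ j ∈ Finset.range (n + 1),
      hatWeight i j Q * ∫ ω in B, payoff n V (r i j) ω ∂μ := by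
  have hint := integrable_payoff_roundedControl hVi hq B
  have hF := integral_natFloor_add_eq_interpolation hQ fun i j => ∫ ω in B, payoff n V (r i j) ω ∂μ
  rw [← hF.2]
  calc ∫ ω in B, payoff n V q ω ∂μ
      = ∫ ω in B, (∫ θ in Set.Ico (0 : ℝ) 1, payoff n V (roundedControl q θ) ω) ∂μ := by
        simp_rw [integral_payoff_roundedControl V hq]
    _ = ∫ θ in Set.Ico (0 : ℝ) 1, ∫ ω in B, payoff n V (roundedControl q θ) ω ∂μ :=
        (integral_integral_swap hint).symm
    _ ≤ _ := by
        refine setIntegral_mono_on hint.integral_prod_left hF.1 measurableSet_Ico fun θ hθ => ?_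
        exact ((hr _ _ (Nat.floor_le_floor (by linarith [hQ.2.1]))
          (natFloor_add_le hQ.2.2 hθ.2)).setIntegral_le hVi hB
          ((isBinaryControlOn_roundedControl hq hθ.2).mono (Set.subset_univ _))).2

/-! ### Optimal controls and the premium -/

lemma isAdmissible_mixedControl {ℱ : Filtration ℕ mΩ} {n : ℕ} {r : ℕ → ℕ → ℕ → Ω → ℝ}
    (hr : ∀ i j, i ≤ j → j ≤ n → IsBinaryControlOn ℱ n i j Set.univ (r i j)) {Q : ℝ × ℝ}
    (hQ : Q ∈ constraintSet n) : IsAdmissible ℱ n Q (mixedControl n r Q) := by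
  have hle : ∀ (x y : ℕ → ℕ → ℝ), (∀ i j, i ≤ j → j ≤ n → x i j ≤ y i j) →
      ∑ i ∈ Finset.range (n + 1), ∑ j ∈ Finset.range (n + 1), hatWeight i j Q * x i j ≤
      ∑ i ∈ Finset.range (n + 1), ∑ j ∈ Finset.range (n + 1), hatWeight i j Q * y i j := by
    refine fun x y h => Finset.sum_le_sum fun i _ => Finset.sum_le_sum fun j hj => ?_
    by_cases hw : hatWeight i j Q = 0
    · simp [hw]
    · exact mul_le_mul_of_nonneg_left (h i j (le_of_hatWeight_ne_zero hQ.1 hQ.2.1 hw)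
        (Nat.lt_succ_iff.1 (Finset.mem_range.1 hj))) (hatWeight_nonneg _ _ _)
  refine ⟨fun k hk => ?_, fun k hk ω => ⟨?_, ?_⟩, fun ω => ?_⟩
  · refine Finset.measurable_fun_sum _ fun i _ => Finset.measurable_fun_sum _ fun j hj => ?_
    by_cases hw : hatWeight i j Q = 0
    · simp only [hw, zero_mul]
      exact measurable_const
    · exact ((hr i j (le_of_hatWeight_ne_zero hQ.1 hQ.2.1 hw)
        (Nat.lt_succ_iff.1 (Finset.mem_range.1 hj))).measurable k hk).const_mul _
  · simpa [mixedControl] using hle 0 (fun i j => r i j k ω)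
      fun i j hij hj => ((hr i j hij hj).mem_Icc k hk ω).1
  · simpa [mixedControl, sum_hatWeight hQ] using hle (fun i j => r i j k ω) 1
      fun i j hij hj => ((hr i j hij hj).mem_Icc k hk ω).2
  · have hsum : ∑ k ∈ Finset.range n, mixedControl n r Q k ω =
        ∑ i ∈ Finset.range (n + 1), ∑ j ∈ Finset.range (n + 1),
          hatWeight i j Q * ∑ k ∈ Finset.range n, r i j k ω := by
      simp only [mixedControl, Finset.mul_sum]
      rw [Finset.sum_comm]
      exact Finset.sum_congr rfl fun i _ => Finset.sum_comm
    rw [hsum]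
    constructor
    · rw [← sum_hatWeight_mul_fst hQ]
      exact hle _ _ fun i j hij hj => ((hr i j hij hj).sum_mem ω trivial).1
    · rw [← sum_hatWeight_mul_snd hQ]
      exact hle _ _ fun i j hij hj => ((hr i j hij hj).sum_mem ω trivial).2

lemma IsAdmissible.integrable_payoff {μ : Measure Ω} {ℱ : Filtration ℕ mΩ} {n : ℕ} {Q : ℝ × ℝ}
    {V q : ℕ → Ω → ℝ} (hq : IsAdmissible ℱ n Q q) (hVi : ∀ k < n, Integrable (V k) μ) :
    Integrable (payoff n V q) μ :=
  Swing.integrable_payoff hVi hq.1 hq.2.1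

lemma reward_le_reward {μ : Measure Ω} [IsFiniteMeasure μ] {ℱ : Filtration ℕ mΩ} {n : ℕ}
    {V p q : ℕ → Ω → ℝ} (hp : Integrable (payoff n V p) μ) (hq : Integrable (payoff n V q) μ)
    (h : ∀ B, MeasurableSet[ℱ 0] B →
      ∫ ω in B, payoff n V p ω ∂μ ≤ ∫ ω in B, payoff n V q ω ∂μ) :
    reward μ ℱ n V p ≤ᵐ[μ] reward μ ℱ n V q := by
  have := condExp_nonneg_of_forall_setIntegral_nonneg (ℱ.le 0) (hq.sub hp) fun B hB => by
    rw [integral_sub' hq.integrableOn hp.integrableOn, sub_nonneg]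
    exact h B hB
  filter_upwards [this, condExp_sub hq hp (ℱ 0)] with ω h1 h2
  rw [h2] at h1
  exact sub_nonneg.1 h1

/-- If an admissible control has the largest reward, this reward is the premium. -/
lemma isEssSup_premium_of_forall_reward_le {μ : Measure Ω} {ℱ : Filtration ℕ mΩ} {n : ℕ}
    {Q : ℝ × ℝ} {V q : ℕ → Ω → ℝ} (hq : IsAdmissible ℱ n Q q)
    (h : ∀ p, IsAdmissible ℱ n Q p → reward μ ℱ n V p ≤ᵐ[μ] reward μ ℱ n V q) :
    IsEssSup μ (rewardSet μ ℱ n V Q) (premium μ ℱ n V Q) ∧ IsOptimal μ ℱ n V Q q := by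
  have hmem : reward μ ℱ n V q ∈ rewardSet μ ℱ n V Q := ⟨q, hq, rfl⟩
  have hmeas : Measurable (reward μ ℱ n V q) :=
    stronglyMeasurable_condExp.measurable.mono (ℱ.le 0) le_rfl
  have hub : ∀ f ∈ rewardSet μ ℱ n V Q, f ≤ᵐ[μ] reward μ ℱ n V q := by
    rintro f ⟨p, hp, rfl⟩
    exact h p hp
  have hex : ∃ X, IsEssSup μ (rewardSet μ ℱ n V Q) X := ⟨_, hmeas, hub, fun Y _ hY => hY _ hmem⟩
  have hprem : IsEssSup μ (rewardSet μ ℱ n V Q) (premium μ ℱ n V Q) := by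
    rw [premium, esssup, dif_pos hex]
    exact hex.choose_spec
  exact ⟨hprem, hq, (hprem.2.1 _ hmem).antisymm (hprem.2.2 _ hmeas hub)⟩

theorem isOptimal_mixedControl {μ : Measure Ω} [IsFiniteMeasure μ] {ℱ : Filtration ℕ mΩ} {n : ℕ}
    {V : ℕ → Ω → ℝ} (hVi : ∀ k < n, Integrable (V k) μ) {r : ℕ → ℕ → ℕ → Ω → ℝ}
    (hr : ∀ i j, i ≤ j → j ≤ n → IsBinaryOptimal μ ℱ n V i j (r i j)) {Q : ℝ × ℝ}
    (hQ : Q ∈ constraintSet n) :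
    IsEssSup μ (rewardSet μ ℱ n V Q) (premium μ ℱ n V Q) ∧
      IsOptimal μ ℱ n V Q (mixedControl n r Q) := by
  have hadm := isAdmissible_mixedControl (fun i j hij hj => (hr i j hij hj).control) hQ
  refine isEssSup_premium_of_forall_reward_le hadm fun p hp =>
    reward_le_reward (hp.integrable_payoff hVi) (hadm.integrable_payoff hVi) fun B hB => ?_
  refine (setIntegral_payoff_le hVi hr hQ hp hB).trans (le_of_eq ?_)
  have hi : ∀ i, ∀ j ∈ Finset.range (n + 1),
      Integrable (fun ω => hatWeight i j Q * payoff n V (r i j) ω) (μ.restrict B) := by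
    intro i j hj
    by_cases hw : hatWeight i j Q = 0
    · simp [hw]
    · exact ((hr i j (le_of_hatWeight_ne_zero hQ.1 hQ.2.1 hw)
        (Nat.lt_succ_iff.1 (Finset.mem_range.1 hj))).control.integrable_payoff
          hVi).integrableOn.const_mul _
  simp_rw [payoff_mixedControl]
  rw [integral_finsetSum _ fun i _ => integrable_finsetSum _ (hi i)]
  refine Finset.sum_congr rfl fun i _ => ?_
  rw [integral_finsetSum _ (hi i)]
  exact Finset.sum_congr rfl fun j _ => (integral_const_mul _ _).symm

/-- The premium is the interpolation of its values at the integer constraints. -/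
theorem premium_eq_interpolation {μ : Measure Ω} [IsFiniteMeasure μ] {ℱ : Filtration ℕ mΩ} {n : ℕ}
    {V : ℕ → Ω → ℝ} (hVi : ∀ k < n, Integrable (V k) μ) {r : ℕ → ℕ → ℕ → Ω → ℝ}
    (hr : ∀ i j, i ≤ j → j ≤ n → IsBinaryOptimal μ ℱ n V i j (r i j)) {Q : ℝ × ℝ}
    (hQ : Q ∈ constraintSet n) :
    premium μ ℱ n V Q =ᵐ[μ] fun ω => ∑ i ∈ Finset.range (n + 1), ∑ j ∈ Finset.range (n + 1),
      hatWeight i j Q * reward μ ℱ n V (r i j) ω := by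
  refine (isOptimal_mixedControl hVi hr hQ).2.2.symm.trans ?_
  have hi : ∀ i, ∀ j ∈ Finset.range (n + 1),
      Integrable (hatWeight i j Q • payoff n V (r i j)) μ := by
    intro i j hj
    by_cases hw : hatWeight i j Q = 0
    · simp [hw]
    · exact ((hr i j (le_of_hatWeight_ne_zero hQ.1 hQ.2.1 hw)
        (Nat.lt_succ_iff.1 (Finset.mem_range.1 hj))).control.integrable_payoff hVi).smul _
  have h1 : payoff n V (mixedControl n r Q) = ∑ i ∈ Finset.range (n + 1),
      ∑ j ∈ Finset.range (n + 1), hatWeight i j Q • payoff n V (r i j) := by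
    ext ω
    simp [payoff_mixedControl, Finset.sum_apply]
  have h2 := condExp_finsetSum (m := ℱ 0) (s := Finset.range (n + 1))
    (f := fun i => ∑ j ∈ Finset.range (n + 1), hatWeight i j Q • payoff n V (r i j))
    (fun i _ => integrable_finsetSum' _ (hi i))
  have h3 : ∀ᵐ ω ∂μ, ∀ i, (μ[∑ j ∈ Finset.range (n + 1), hatWeight i j Q • payoff n V (r i j)
      | ℱ 0]) ω = (∑ j ∈ Finset.range (n + 1), μ[hatWeight i j Q • payoff n V (r i j) | ℱ 0]) ω :=
    ae_all_iff.2 fun i => condExp_finsetSum (hi i) (ℱ 0)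
  have h4 : ∀ᵐ ω ∂μ, ∀ i j, (μ[hatWeight i j Q • payoff n V (r i j) | ℱ 0]) ω =
      (hatWeight i j Q • μ[payoff n V (r i j) | ℱ 0]) ω :=
    ae_all_iff.2 fun i => ae_all_iff.2 fun j => condExp_smul _ _ _
  have h0 : reward μ ℱ n V (mixedControl n r Q) =
      μ[payoff n V (mixedControl n r Q) | ℱ 0] := rfl
  rw [h0, h1]
  filter_upwards [h2, h3, h4] with ω h2 h3 h4
  rw [h2, Finset.sum_apply]
  refine Finset.sum_congr rfl fun i _ => ?_
  rw [h3, Finset.sum_apply]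
  refine Finset.sum_congr rfl fun j _ => ?_
  rw [h4]
  rfl

end

/-! ### Properties of the premium -/

section

lemma convex_constraintSet (n : ℕ) : Convex ℝ (constraintSet n) := by
  intro x hx y hy a b ha hb hab
  obtain ⟨h1, h2, h3⟩ := hx
  obtain ⟨h1', h2', h3'⟩ := hy
  simp only [constraintSet, Set.mem_ofPred_eq, Prod.fst_add, Prod.snd_add, Prod.smul_fst,
    Prod.smul_snd, smul_eq_mul]
  refine ⟨by positivity, by gcongr, ?_⟩
  calc a * x.2 + b * y.2 ≤ a * n + b * n := by gcongr
    _ = n := by rw [← add_mul, hab, one_mul]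

variable {Ω : Type*} [mΩ : MeasurableSpace Ω]

section Premium

variable {μ : Measure Ω} {ℱ : Filtration ℕ mΩ} {n : ℕ} {V : ℕ → Ω → ℝ}

lemma reward_convexComb {q q' : ℕ → Ω → ℝ} (hq : Integrable (payoff n V q) μ)
    (hq' : Integrable (payoff n V q') μ) (s t : ℝ) :
    reward μ ℱ n V (fun k ω => s * q k ω + t * q' k ω) =ᵐ[μ]
      fun ω => s * reward μ ℱ n V q ω + t * reward μ ℱ n V q' ω := by
  have h0 : reward μ ℱ n V (fun k ω => s * q k ω + t * q' k ω) =
      μ[s • payoff n V q + t • payoff n V q' | ℱ 0] := by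
    unfold reward
    congr 1
    ext ω
    simp only [payoff, Pi.add_apply, Pi.smul_apply, smul_eq_mul, Finset.mul_sum,
      ← Finset.sum_add_distrib]
    exact Finset.sum_congr rfl fun k _ => by ring
  rw [h0]
  filter_upwards [condExp_add (hq.smul s) (hq'.smul t) (ℱ 0),
    condExp_smul s (payoff n V q) (ℱ 0), condExp_smul t (payoff n V q') (ℱ 0)] with ω h1 h2 h3
  rw [h1, Pi.add_apply, h2, h3]
  rfl

lemma reward_mono_of_nonneg {q q' : ℕ → Ω → ℝ} (hV : ∀ k < n, 0 ≤ᵐ[μ] V k)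
    (hq : Integrable (payoff n V q) μ) (hq' : Integrable (payoff n V q') μ)
    (h : ∀ k < n, ∀ ω, q k ω ≤ q' k ω) : reward μ ℱ n V q ≤ᵐ[μ] reward μ ℱ n V q' := by
  refine condExp_mono hq hq' ?_
  have hV' : ∀ᵐ ω ∂μ, ∀ k, k < n → 0 ≤ V k ω := ae_all_iff.2 fun k => by
    by_cases hk : k < n
    · filter_upwards [hV k hk] with ω hω _ using hω
    · exact Filter.Eventually.of_forall fun ω h' => absurd h' hk
  filter_upwards [hV'] with ω hω
  refine Finset.sum_le_sum fun k hk => ?_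
  rw [Finset.mem_range] at hk
  exact mul_le_mul_of_nonneg_right (h k hk ω) (hω k hk)

/-- A control can be increased to saturate the upper global constraint: the cumulative quantity
`S_k` is replaced by `max S_k (v - (n - k))`, the second term being the smallest quantity at time
`k` from which the total `v` can still be reached. -/
lemma exists_isAdmissible_ge {Q : ℝ × ℝ} (hQ : Q ∈ constraintSet n) {q : ℕ → Ω → ℝ}
    (hq : IsAdmissible ℱ n Q q) :
    ∃ q', IsAdmissible ℱ n (Q.2, Q.2) q' ∧ ∀ k < n, ∀ ω, q k ω ≤ q' k ω := by
  let S : ℕ → Ω → ℝ := fun k ω => max (∑ j ∈ Finset.range k, q j ω) (Q.2 - (n - k))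
  have hm : ∀ k < n, ∀ l ≤ k + 1, Measurable[ℱ k] (S l) := fun k hk l hl => by
    refine Measurable.max (Finset.measurable_fun_sum _ fun j hj => ?_) measurable_const
    have := Finset.mem_range.1 hj
    exact (hq.1 j (by omega)).mono (ℱ.mono (by omega)) le_rfl
  have hstep : ∀ k < n, ∀ ω, q k ω ≤ S (k + 1) ω - S k ω ∧ S (k + 1) ω - S k ω ≤ 1 := by
    intro k hk ω
    have h := hq.2.1 k hk ω
    simp only [S]
    rw [Finset.sum_range_succ]
    push_cast
    rcases le_total (∑ j ∈ Finset.range k, q j ω) (Q.2 - (n - k)) with h' | h'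
    · rw [max_eq_right h', max_eq_right (by linarith [h.2])]
      constructor <;> linarith [h.2]
    · rw [max_eq_left h']
      constructor
      · linarith [le_max_left (∑ j ∈ Finset.range k, q j ω + q k ω) (Q.2 - (n - (k + 1)))]
      · rw [sub_le_iff_le_add, max_le_iff]
        constructor <;> linarith [h.2]
  refine ⟨fun k ω => S (k + 1) ω - S k ω, ⟨fun k hk => ?_, fun k hk ω => ?_, fun ω => ?_⟩,
    fun k hk ω => (hstep k hk ω).1⟩
  · exact (hm k hk (k + 1) le_rfl).sub (hm k hk k (Nat.le_succ k))
  · exact ⟨(hq.2.1 k hk ω).1.trans (hstep k hk ω).1, (hstep k hk ω).2⟩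
  · have h0 : S 0 ω = 0 := by
      simp only [S, Finset.sum_range_zero, Nat.cast_zero, sub_zero]
      exact max_eq_left (by linarith [hQ.2.2])
    have h1 : S n ω = Q.2 := by
      simp only [S, sub_self, sub_zero]
      exact max_eq_right (hq.2.2 ω).2
    rw [Finset.sum_range_sub fun k => S k ω, h0, h1]
    simp

lemma premium_le_premium {Q Q' : ℝ × ℝ}
    (hQ : IsEssSup μ (rewardSet μ ℱ n V Q) (premium μ ℱ n V Q))
    (hQ' : IsEssSup μ (rewardSet μ ℱ n V Q') (premium μ ℱ n V Q'))
    (h : ∀ q, IsAdmissible ℱ n Q q → ∃ q', IsAdmissible ℱ n Q' q' ∧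
      reward μ ℱ n V q ≤ᵐ[μ] reward μ ℱ n V q') :
    premium μ ℱ n V Q ≤ᵐ[μ] premium μ ℱ n V Q' := by
  refine hQ.2.2 _ hQ'.1 ?_
  rintro f ⟨q, hq, rfl⟩
  obtain ⟨q', hq', hle⟩ := h q hq
  exact hle.trans (hQ'.2.1 _ ⟨q', hq', rfl⟩)

lemma IsAdmissible.mono {Q Q' : ℝ × ℝ} {q : ℕ → Ω → ℝ} (hq : IsAdmissible ℱ n Q q)
    (h1 : Q'.1 ≤ Q.1) (h2 : Q.2 ≤ Q'.2) : IsAdmissible ℱ n Q' q :=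
  ⟨hq.1, hq.2.1, fun ω => ⟨h1.trans (hq.2.2 ω).1, (hq.2.2 ω).2.trans h2⟩⟩

lemma zero_mk_mem_constraintSet {Q : ℝ × ℝ} (hQ : Q ∈ constraintSet n) :
    ((0, Q.2) : ℝ × ℝ) ∈ constraintSet n :=
  ⟨le_rfl, hQ.1.trans hQ.2.1, hQ.2.2⟩

lemma diag_mem_constraintSet {Q : ℝ × ℝ} (hQ : Q ∈ constraintSet n) :
    ((Q.2, Q.2) : ℝ × ℝ) ∈ constraintSet n :=
  ⟨hQ.1.trans hQ.2.1, le_rfl, hQ.2.2⟩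

lemma natCast_mem_constraintSet {a b : ℕ} (hab : a ≤ b) (hbn : b ≤ n) :
    ((a, b) : ℝ × ℝ) ∈ constraintSet n :=
  ⟨Nat.cast_nonneg a, Nat.cast_le.2 hab, Nat.cast_le.2 hbn⟩

/-- For nonnegative payoffs only the upper global constraint matters. -/
lemma premium_eq_of_nonneg (hVi : ∀ k < n, Integrable (V k) μ) (hV : ∀ k < n, 0 ≤ᵐ[μ] V k)
    (hess : ∀ Q ∈ constraintSet n, IsEssSup μ (rewardSet μ ℱ n V Q) (premium μ ℱ n V Q))
    {Q : ℝ × ℝ} (hQ : Q ∈ constraintSet n) :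
    premium μ ℱ n V Q =ᵐ[μ] premium μ ℱ n V (0, Q.2) ∧
      premium μ ℱ n V Q =ᵐ[μ] premium μ ℱ n V (Q.2, Q.2) := by
  have h0 := zero_mk_mem_constraintSet hQ
  have hd := diag_mem_constraintSet hQ
  have h1 : premium μ ℱ n V Q ≤ᵐ[μ] premium μ ℱ n V (0, Q.2) :=
    premium_le_premium (hess _ hQ) (hess _ h0) fun q hq =>
      ⟨q, hq.mono hQ.1 le_rfl, Filter.EventuallyLE.rfl⟩
  have h2 : premium μ ℱ n V (Q.2, Q.2) ≤ᵐ[μ] premium μ ℱ n V Q :=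
    premium_le_premium (hess _ hd) (hess _ hQ) fun q hq =>
      ⟨q, hq.mono hQ.2.1 le_rfl, Filter.EventuallyLE.rfl⟩
  have h3 : premium μ ℱ n V (0, Q.2) ≤ᵐ[μ] premium μ ℱ n V (Q.2, Q.2) :=
    premium_le_premium (hess _ h0) (hess _ hd) fun q hq => by
      obtain ⟨q', hq', hle⟩ := exists_isAdmissible_ge h0 hq
      exact ⟨q', hq', reward_mono_of_nonneg hV (hq.integrable_payoff hVi)
        (hq'.integrable_payoff hVi) hle⟩
  exact ⟨h1.antisymm (h3.trans h2), (h1.trans h3).antisymm h2⟩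

/-- The premium is concave, since mixtures of admissible controls are admissible for the mixed
constraints. -/
lemma premium_concave (hVi : ∀ k < n, Integrable (V k) μ)
    (hopt : ∀ Q ∈ constraintSet n,
      IsEssSup μ (rewardSet μ ℱ n V Q) (premium μ ℱ n V Q) ∧ ∃ q, IsOptimal μ ℱ n V Q q)
    {Q Q' : ℝ × ℝ} (hQ : Q ∈ constraintSet n) (hQ' : Q' ∈ constraintSet n) {s t : ℝ}
    (hs : 0 ≤ s) (ht : 0 ≤ t) (hst : s + t = 1) :
    ∀ᵐ ω ∂μ, s * premium μ ℱ n V Q ω + t * premium μ ℱ n V Q' ω ≤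
      premium μ ℱ n V (s • Q + t • Q') ω := by
  obtain ⟨q, hq, hqo⟩ := (hopt Q hQ).2
  obtain ⟨q', hq', hqo'⟩ := (hopt Q' hQ').2
  have hadm : IsAdmissible ℱ n (s • Q + t • Q') (fun k ω => s * q k ω + t * q' k ω) := by
    refine ⟨fun k hk => ((hq.1 k hk).const_mul s).add ((hq'.1 k hk).const_mul t),
      fun k hk ω => (convex_Icc (0 : ℝ) 1) (hq.2.1 k hk ω) (hq'.2.1 k hk ω) hs ht hst,
      fun ω => ?_⟩
    rw [Finset.sum_add_distrib, ← Finset.mul_sum, ← Finset.mul_sum]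
    have h := hq.2.2 ω
    have h' := hq'.2.2 ω
    simp only [Prod.fst_add, Prod.smul_fst, Prod.snd_add, Prod.smul_snd, smul_eq_mul]
    constructor
    · exact add_le_add (mul_le_mul_of_nonneg_left h.1 hs) (mul_le_mul_of_nonneg_left h'.1 ht)
    · exact add_le_add (mul_le_mul_of_nonneg_left h.2 hs) (mul_le_mul_of_nonneg_left h'.2 ht)
  have hmem := convex_constraintSet n hQ hQ' hs ht hst
  filter_upwards [hqo, hqo', (hopt _ hmem).1.2.1 _ ⟨_, hadm, rfl⟩,
    reward_convexComb (ℱ := ℱ) (hq.integrable_payoff hVi) (hq'.integrable_payoff hVi) s t]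
    with ω h1 h2 h3 h4
  rw [← h1, ← h2, ← h4]
  exact h3

lemma premium_zero_zero {q : ℕ → Ω → ℝ} (hq : IsOptimal μ ℱ n V (0, 0) q) :
    premium μ ℱ n V (0, 0) =ᵐ[μ] 0 := by
  refine hq.2.symm.trans ?_
  have : reward μ ℱ n V q = μ[(0 : Ω → ℝ) | ℱ 0] := by
    unfold reward
    congr 1
    ext ω
    have h0 : ∀ k ∈ Finset.range n, 0 ≤ q k ω := fun k hk =>
      (hq.1.2.1 k (Finset.mem_range.1 hk) ω).1
    have hs := (hq.1.2.2 ω).2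
    have := (Finset.sum_eq_zero_iff_of_nonneg h0).1 (le_antisymm hs (Finset.sum_nonneg h0))
    exact Finset.sum_eq_zero fun k hk => by rw [this k hk, zero_mul]
  rw [this, condExp_zero]

lemma premium_natCast_natCast {q : ℕ → Ω → ℝ} (hq : IsOptimal μ ℱ n V (n, n) q) :
    premium μ ℱ n V (n, n) =ᵐ[μ] μ[fun ω => ∑ k ∈ Finset.range n, V k ω | ℱ 0] := by
  refine hq.2.symm.trans (Filter.EventuallyEq.of_eq ?_)
  unfold reward
  congr 1
  ext ω
  have h0 : ∀ k ∈ Finset.range n, 0 ≤ 1 - q k ω := fun k hk =>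
    sub_nonneg.2 (hq.1.2.1 k (Finset.mem_range.1 hk) ω).2
  have hs : (n : ℝ) ≤ ∑ k ∈ Finset.range n, q k ω := (hq.1.2.2 ω).1
  have h1 : ∑ k ∈ Finset.range n, (1 - q k ω) ≤ 0 := by
    rw [Finset.sum_sub_distrib]
    simp [hs]
  have := (Finset.sum_eq_zero_iff_of_nonneg h0).1 (le_antisymm h1 (Finset.sum_nonneg h0))
  exact Finset.sum_congr rfl fun k hk => by rw [← sub_eq_zero.1 (this k hk), one_mul]

lemma premium_zero_natCast [IsFiniteMeasure μ] (hVm : ∀ k < n, Measurable[ℱ k] (V k))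
    (hVi : ∀ k < n, Integrable (V k) μ)
    (hess : IsEssSup μ (rewardSet μ ℱ n V (0, n)) (premium μ ℱ n V (0, n))) :
    premium μ ℱ n V (0, n) =ᵐ[μ] μ[fun ω => ∑ k ∈ Finset.range n, max (V k ω) 0 | ℱ 0] := by
  have hadm : IsAdmissible ℱ n (0, n) fun k => {ω | 0 < V k ω}.indicator 1 := by
    have h01 : ∀ k ω, ({ω | 0 < V k ω}.indicator 1 ω : ℝ) ∈ Set.Icc (0 : ℝ) 1 := fun k ω => by
      by_cases h : 0 < V k ω <;> simp [Set.indicator, h]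
    refine ⟨fun k hk => Measurable.indicator measurable_const
      (measurableSet_lt measurable_const (hVm k hk)), fun k _ ω => h01 k ω, fun ω => ⟨?_, ?_⟩⟩
    · exact Finset.sum_nonneg fun k _ => (h01 k ω).1
    · exact (Finset.sum_le_card_nsmul _ _ 1 fun k _ => (h01 k ω).2).trans (by simp)
  have hpay : payoff n V (fun k => {ω | 0 < V k ω}.indicator 1) =
      fun ω => ∑ k ∈ Finset.range n, max (V k ω) 0 := by
    ext ω
    refine Finset.sum_congr rfl fun k _ => ?_
    by_cases h : 0 < V k ω
    · simp [Set.indicator, h, h.le]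
    · simp [Set.indicator, h, not_lt.1 h]
  have hrew : reward μ ℱ n V (fun k => {ω | 0 < V k ω}.indicator 1) =
      μ[fun ω => ∑ k ∈ Finset.range n, max (V k ω) 0 | ℱ 0] := by
    rw [← hpay]; rfl
  rw [← hrew]
  refine (hess.2.2 _ (stronglyMeasurable_condExp.measurable.mono (ℱ.le 0) le_rfl) ?_).antisymm
    (hess.2.1 _ ⟨_, hadm, rfl⟩)
  rintro f ⟨q, hq, rfl⟩
  refine condExp_mono (hq.integrable_payoff hVi) (hadm.integrable_payoff hVi)
    (Filter.Eventually.of_forall fun ω => ?_)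
  show payoff n V q ω ≤ payoff n V _ ω
  rw [hpay]
  refine Finset.sum_le_sum fun k hk => ?_
  have h := hq.2.1 k (Finset.mem_range.1 hk) ω
  rcases le_total 0 (V k ω) with hv | hv
  · exact (mul_le_of_le_one_left hv h.2).trans (le_max_left _ _)
  · exact (mul_nonpos_of_nonneg_of_nonpos h.1 hv).trans (le_max_right _ _)

/-- An optimal `{0, 1}`-valued control for integer constraints is optimal among all controls. -/
lemma IsBinaryOptimal.isOptimal [IsFiniteMeasure μ] (hVm : ∀ k < n, Measurable[ℱ k] (V k))
    (hVi : ∀ k < n, Integrable (V k) μ) {a b : ℕ} (hab : a ≤ b) (hbn : b ≤ n)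
    {q : ℕ → Ω → ℝ} (hq : IsBinaryOptimal μ ℱ n V a b q) : IsOptimal μ ℱ n V (a, b) q := by
  obtain ⟨r, hr⟩ := exists_family_isBinaryOptimal hVm hVi
  have hQ := natCast_mem_constraintSet hab hbn
  have hadm : IsAdmissible ℱ n (a, b) q :=
    ⟨hq.control.measurable, hq.control.mem_Icc, fun ω => hq.control.sum_mem ω trivial⟩
  refine (isEssSup_premium_of_forall_reward_le hadm fun p hp =>
    reward_le_reward (hp.integrable_payoff hVi) (hadm.integrable_payoff hVi) fun B hB => ?_).2
  refine (setIntegral_payoff_le hVi hr hQ hp hB).trans ?_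
  rw [← (integral_natFloor_add_eq_interpolation hQ fun i j => ∫ ω in B, payoff n V (r i j) ω ∂μ).2]
  have hconst : ∫ θ in Set.Ico (0 : ℝ) 1,
      (∫ ω in B, payoff n V (r ⌊(a : ℝ) + θ⌋₊ ⌊(b : ℝ) + θ⌋₊) ω ∂μ) =
      ∫ θ in Set.Ico (0 : ℝ) 1, ∫ ω in B, payoff n V (r a b) ω ∂μ := by
    refine setIntegral_congr_fun measurableSet_Ico fun θ hθ => ?_
    have h : ∀ c : ℕ, ⌊(c : ℝ) + θ⌋₊ = c := fun c =>
      (Nat.floor_eq_iff (add_nonneg c.cast_nonneg hθ.1)).2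
        ⟨by linarith [hθ.1], by linarith [hθ.2]⟩
    simp only [h]
  rw [hconst]
  simpa using (hq.setIntegral_le hVi hB ((hr a b hab hbn).control.mono (Set.subset_univ _))).2

lemma isBangBang_of_binary {a b : ℕ} {q : ℕ → Ω → ℝ} (hq : IsAdmissible ℱ n (a, b) q)
    (h : ∀ k < n, ∀ ω, q k ω = 0 ∨ q k ω = 1) : IsBangBang μ n (a, b) q := by
  refine Filter.Eventually.of_forall fun ω => ?_
  rcases Nat.eq_zero_or_pos b with rfl | hb
  · right
    refine ⟨fun k hk => ?_, Or.inr (le_antisymm (hq.2.2 ω).2 ?_)⟩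
    · exact absurd (hk.2.1.trans hk.2.2) (by simp)
    · simpa using Finset.sum_nonneg fun k hk => (hq.2.1 k (Finset.mem_range.1 hk) ω).1
  · left
    have : min (1 : ℝ) b = 1 := min_eq_left (by exact_mod_cast hb)
    simpa [this] using fun k hk => h k hk ω

end Premium

end

/-! ### Regular paths and bang-bang controls -/

section

/-- Linearity of the hat functions along the diagonal between consecutive integers. -/
lemma hatWeight_diag (i j m : ℕ) {s : ℝ} (hs0 : 0 ≤ s) (hs1 : s ≤ 1) :
    hatWeight i j (m + s, m + s) =
      (1 - s) * hatWeight i j (m, m) + s * hatWeight i j ((m + 1 : ℕ), (m + 1 : ℕ)) := by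
  obtain ⟨a, b, c, h⟩ := isAffineOn_hatWeight_upperTriangle i j m m
  have hmem : ∀ x : ℝ, 0 ≤ x → x ≤ 1 → ((m + x, m + x) : ℝ × ℝ) ∈ upperTriangle m m :=
    fun x h0 h1 => by
      refine ⟨⟨?_, ?_⟩, ⟨?_, ?_⟩, ?_⟩ <;> simp [h0, h1]
  have e0 := h _ (hmem 0 le_rfl zero_le_one)
  have e1 := h _ (hmem 1 zero_le_one le_rfl)
  have e2 := h _ (hmem s hs0 hs1)
  simp only [add_zero] at e0
  push_cast
  rw [e0, e1, e2]
  ring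

lemma IsAffineOn.sum {ι : Type*} (t : Finset ι) {f : ι → ℝ × ℝ → ℝ} {S : Set (ℝ × ℝ)}
    (h : ∀ i ∈ t, IsAffineOn (f i) S) : IsAffineOn (fun Q => ∑ i ∈ t, f i Q) S := by
  classical
  induction t using Finset.induction_on with
  | empty => exact ⟨0, 0, 0, fun Q _ => by simp⟩
  | insert i t hi ih =>
    obtain ⟨a, b, c, h1⟩ := h i (Finset.mem_insert_self i t)
    obtain ⟨a', b', c', h2⟩ := ih fun j hj => h j (Finset.mem_insert_of_mem hj)
    refine ⟨a + a', b + b', c + c', fun Q hQ => ?_⟩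
    have e := h2 Q hQ
    simp only at e ⊢
    rw [Finset.sum_insert hi, h1 Q hQ, e]
    ring

lemma IsAffineOn.mul_const {f : ℝ × ℝ → ℝ} {S : Set (ℝ × ℝ)} (h : IsAffineOn f S) (x : ℝ) :
    IsAffineOn (fun Q => f Q * x) S := by
  obtain ⟨a, b, c, h1⟩ := h
  exact ⟨a * x, b * x, c * x, fun Q hQ => by simp only [h1 Q hQ]; ring⟩

/-- The function of `Q` interpolating the values `A i j` at the integer points on the tiling. -/
noncomputable def interpolate (n : ℕ) (A : ℕ → ℕ → ℝ) (Q : ℝ × ℝ) : ℝ :=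
  ∑ i ∈ Finset.range (n + 1), ∑ j ∈ Finset.range (n + 1), hatWeight i j Q * A i j

lemma continuous_interpolate (n : ℕ) (A : ℕ → ℕ → ℝ) : Continuous (interpolate n A) :=
  continuous_finsetSum _ fun i _ => continuous_finsetSum _ fun j _ =>
    (continuous_hatWeight i j).mul continuous_const

lemma isAffineOn_interpolate {n : ℕ} {S : Set (ℝ × ℝ)}
    (h : ∀ i j, IsAffineOn (hatWeight i j) S) (A : ℕ → ℕ → ℝ) :
    IsAffineOn (interpolate n A) S :=
  IsAffineOn.sum _ fun i _ => IsAffineOn.sum _ fun j _ => (h i j).mul_const _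

/-- The parameters of the concavity inequality: two points and a weight. -/
abbrev ConcavityIndex (n : ℕ) : Type :=
  constraintSet n × constraintSet n × Set.Icc (0 : ℝ) 1

variable {Ω : Type*} [mΩ : MeasurableSpace Ω]

/-- A random field which interpolates measurable values at the integer points and is, for all fixed
`Q`, a version of a field that is concave at each fixed triple of points, has a version with
concave, continuous paths that are affine on the triangles. Concavity at a countable dense set of
triples suffices, by continuity, and fails only on a null event of `m`, where the field is set to
zero. -/
lemma exists_regular_version {μ : Measure Ω} {m : MeasurableSpace Ω} (n : ℕ)
    {A : ℕ → ℕ → Ω → ℝ} (hA : ∀ i j, Measurable[m] (A i j)) {X : ℝ × ℝ → Ω → ℝ}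
    (hX : ∀ Q ∈ constraintSet n, X Q =ᵐ[μ] fun ω => interpolate n (fun i j => A i j ω) Q)
    (hconc : ∀ Q ∈ constraintSet n, ∀ Q' ∈ constraintSet n, ∀ s t : ℝ, 0 ≤ s → 0 ≤ t → s + t = 1 →
      ∀ᵐ ω ∂μ, s * X Q ω + t * X Q' ω ≤ X (s • Q + t • Q') ω) :
    ∃ P : ℝ × ℝ → Ω → ℝ,
      (∀ Q ∈ constraintSet n, Measurable[m] (P Q) ∧ P Q =ᵐ[μ] X Q) ∧
      ∀ ω, ConcaveOn ℝ (constraintSet n) (fun Q => P Q ω) ∧ Continuous (fun Q => P Q ω) ∧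
        (∀ i j : ℕ, IsAffineOn (fun Q => P Q ω) (upperTriangle i j)) ∧
        (∀ i j : ℕ, IsAffineOn (fun Q => P Q ω) (lowerTriangle i j)) := by
  classical
  set P₀ : ℝ × ℝ → Ω → ℝ := fun Q ω => interpolate n (fun i j => A i j ω) Q
  have hP₀m : ∀ Q, Measurable[m] (P₀ Q) := fun Q =>
    Finset.measurable_fun_sum _ fun i _ => Finset.measurable_fun_sum _ fun j _ =>
      (hA i j).const_mul _
  have : Nonempty (ConcavityIndex n) := by
    have h : ((0, 0) : ℝ × ℝ) ∈ constraintSet n := ⟨le_rfl, le_rfl, n.cast_nonneg⟩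
    exact ⟨⟨_, h⟩, ⟨_, h⟩, ⟨0, le_rfl, zero_le_one⟩⟩
  -- the gap in the concavity inequality
  let δ : ConcavityIndex n → Ω → ℝ := fun z ω => 
    P₀ ((1 - (z.2.2 : ℝ)) • (z.1 : ℝ × ℝ) + (z.2.2 : ℝ) • (z.2.1 : ℝ × ℝ)) ω -
    ((1 - (z.2.2 : ℝ)) * P₀ z.1 ω + (z.2.2 : ℝ) * P₀ z.2.1 ω)
  have hδc : ∀ ω, Continuous fun z => δ z ω := fun ω => by
    have hc := continuous_interpolate n fun i j => A i j ω
    have h1 : Continuous fun z : ConcavityIndex n => interpolate n (fun i j => A i j ω)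
        ((1 - (z.2.2 : ℝ)) • (z.1 : ℝ × ℝ) + (z.2.2 : ℝ) • (z.2.1 : ℝ × ℝ)) :=
      hc.comp (by fun_prop)
    have h2 : Continuous fun z : ConcavityIndex n =>
        interpolate n (fun i j => A i j ω) (z.1 : ℝ × ℝ) :=
      hc.comp (by fun_prop)
    have h3 : Continuous fun z : ConcavityIndex n =>
        interpolate n (fun i j => A i j ω) (z.2.1 : ℝ × ℝ) :=
      hc.comp (by fun_prop)
    exact h1.sub (((continuous_const.sub (by fun_prop)).mul h2).add
      (Continuous.mul (by fun_prop) h3))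
  let G : Set Ω := {ω | ∀ l : ℕ, 0 ≤ δ (TopologicalSpace.denseSeq (ConcavityIndex n) l) ω}
  have hGm : MeasurableSet[m] G := by
    have : G = ⋂ l : ℕ, {ω | 0 ≤ δ (TopologicalSpace.denseSeq (ConcavityIndex n) l) ω} := by
      ext; simp [G]
    rw [this]
    refine MeasurableSet.iInter fun l => measurableSet_le measurable_const ?_
    exact (hP₀m _).sub (((hP₀m _).const_mul _).add ((hP₀m _).const_mul _))
  have hG : ∀ᵐ ω ∂μ, ω ∈ G := by
    refine ae_all_iff.2 fun l => ?_
    set z := TopologicalSpace.denseSeq (ConcavityIndex n) l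
    have hs : (0 : ℝ) ≤ 1 - z.2.2 := sub_nonneg.2 z.2.2.2.2
    have ht : (0 : ℝ) ≤ z.2.2 := z.2.2.2.1
    filter_upwards [hconc _ z.1.2 _ z.2.1.2 _ _ hs ht (by ring), hX _ z.1.2, hX _ z.2.1.2,
      hX _ (convex_constraintSet n z.1.2 z.2.1.2 hs ht (by ring))] with ω h h1 h2 h3
    rw [h1, h2, h3] at h
    exact sub_nonneg.2 h
  have hGδ : ∀ ω ∈ G, ∀ z, 0 ≤ δ z ω := fun ω hω =>
    isClosed_property (TopologicalSpace.denseRange_denseSeq (ConcavityIndex n))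
      (isClosed_le continuous_const (hδc ω)) hω
  refine ⟨fun Q ω => if ω ∈ G then P₀ Q ω else 0, fun Q hQ => ⟨?_, ?_⟩, fun ω => ?_⟩
  · exact Measurable.ite hGm (hP₀m Q) measurable_const
  · filter_upwards [hG, hX Q hQ] with ω h1 h2
    rw [if_pos h1, h2]
  · by_cases hω : ω ∈ G
    · simp only [if_pos hω]
      refine ⟨⟨convex_constraintSet n, fun x hx y hy s t hs ht hst => ?_⟩,
        continuous_interpolate n _, fun i j => isAffineOn_interpolate
          (fun _ _ => isAffineOn_hatWeight_upperTriangle _ _ _ _) _, fun i j =>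
        isAffineOn_interpolate (fun _ _ => isAffineOn_hatWeight_lowerTriangle _ _ _ _) _⟩
      obtain rfl : s = 1 - t := by linarith
      exact sub_nonneg.1 (hGδ ω hω ⟨⟨x, hx⟩, ⟨y, hy⟩, ⟨t, ht, by linarith⟩⟩)
    · simp only [if_neg hω]
      exact ⟨concaveOn_const 0 (convex_constraintSet n), continuous_const,
        fun i j => ⟨0, 0, 0, fun Q _ => by ring⟩, fun i j => ⟨0, 0, 0, fun Q _ => by ring⟩⟩

/-- For nonnegative payoffs the paths of a continuous version of the premium increase along the
diagonal; a countable dense set of pairs of quantities suffices. -/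
lemma ae_monotoneOn_diag {μ : Measure Ω} {ℱ : Filtration ℕ mΩ} {n : ℕ} {V : ℕ → Ω → ℝ}
    (hVi : ∀ k < n, Integrable (V k) μ) (hV : ∀ k < n, 0 ≤ᵐ[μ] V k)
    (hess : ∀ Q ∈ constraintSet n, IsEssSup μ (rewardSet μ ℱ n V Q) (premium μ ℱ n V Q))
    {P : ℝ × ℝ → Ω → ℝ} (hP : ∀ Q ∈ constraintSet n, P Q =ᵐ[μ] premium μ ℱ n V Q)
    (hPc : ∀ ω, Continuous fun Q => P Q ω) :
    ∀ᵐ ω ∂μ, MonotoneOn (fun v : ℝ => P (v, v) ω) (Set.Icc 0 (n : ℝ)) := by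
  have : Nonempty (constraintSet n) := ⟨⟨(0, 0), le_rfl, le_rfl, n.cast_nonneg⟩⟩
  have hfix : ∀ Q ∈ constraintSet n, ∀ᵐ ω ∂μ, P (Q.1, Q.1) ω ≤ P (Q.2, Q.2) ω := fun Q hQ => by
    have hd := diag_mem_constraintSet hQ
    have hd' : ((Q.1, Q.1) : ℝ × ℝ) ∈ constraintSet n := ⟨hQ.1, le_rfl, hQ.2.1.trans hQ.2.2⟩
    have h0 := zero_mk_mem_constraintSet hQ
    have hle : premium μ ℱ n V (Q.1, Q.1) ≤ᵐ[μ] premium μ ℱ n V (0, Q.2) :=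
      premium_le_premium (hess _ hd') (hess _ h0) fun q hq =>
        ⟨q, hq.mono hQ.1 hQ.2.1, Filter.EventuallyLE.rfl⟩
    filter_upwards [hle, (premium_eq_of_nonneg hVi hV hess h0).2, hP _ hd, hP _ hd']
      with ω h1 h2 h3 h4
    rw [h3, h4]
    exact h1.trans h2.le
  have hdense : ∀ᵐ ω ∂μ, ∀ l : ℕ,
      P ((TopologicalSpace.denseSeq (constraintSet n) l : ℝ × ℝ).1,
        (TopologicalSpace.denseSeq (constraintSet n) l : ℝ × ℝ).1) ω ≤
      P ((TopologicalSpace.denseSeq (constraintSet n) l : ℝ × ℝ).2,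
        (TopologicalSpace.denseSeq (constraintSet n) l : ℝ × ℝ).2) ω :=
    ae_all_iff.2 fun l => hfix _ (TopologicalSpace.denseSeq (constraintSet n) l).2
  filter_upwards [hdense] with ω hω x hx y hy hxy
  have h1 : Continuous fun z : constraintSet n => P ((z : ℝ × ℝ).1, (z : ℝ × ℝ).1) ω :=
    (hPc ω).comp (by fun_prop)
  have h2 : Continuous fun z : constraintSet n => P ((z : ℝ × ℝ).2, (z : ℝ × ℝ).2) ω :=
    (hPc ω).comp (by fun_prop)
  exact isClosed_property (TopologicalSpace.denseRange_denseSeq (constraintSet n))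
    (isClosed_le h1 h2) hω ⟨(x, y), hx.1, hxy, hy.2⟩

/-- If `Q.1 = Q.2 = m + s`, mixing nested optimal integer controls with `m` and `m + 1` exercise
dates is optimal, and since these two differ at a single date, the mixture is bang-bang. -/
lemma exists_isBangBang_diag {μ : Measure Ω} [IsFiniteMeasure μ] {ℱ : Filtration ℕ mΩ} {n : ℕ}
    {V : ℕ → Ω → ℝ} (hVm : ∀ k < n, Measurable[ℱ k] (V k)) (hVi : ∀ k < n, Integrable (V k) μ)
    {v : ℝ} (hv0 : 0 ≤ v) (hvn : v ≤ n) :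
    ∃ q, IsOptimal μ ℱ n V (v, v) q ∧
      ∀ ω, {k | k < n ∧ q k ω ∈ Set.Ioo (0 : ℝ) 1}.Subsingleton := by
  obtain ⟨r, hr⟩ := exists_family_isBinaryOptimal hVm hVi
  rcases Nat.eq_zero_or_pos n with rfl | hn
  · exact ⟨_, (isOptimal_mixedControl hVi hr ⟨hv0, le_rfl, hvn⟩).2, fun ω k hk => by
      simp at hk⟩
  -- for `v = n` the choice `m = n - 1`, `s = 1` keeps `m + 1 ≤ n`
  obtain ⟨m, s, hm, hs0, hs1, rfl⟩ : ∃ (m : ℕ) (s : ℝ), m < n ∧ 0 ≤ s ∧ s ≤ 1 ∧ v = m + s := by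
    rcases hvn.lt_or_eq with h | rfl
    · exact ⟨⌊v⌋₊, v - ⌊v⌋₊, (Nat.floor_lt hv0).2 h, sub_nonneg.2 (Nat.floor_le hv0),
        by linarith [Nat.lt_floor_add_one v], by ring⟩
    · refine ⟨n - 1, 1, by omega, zero_le_one, le_rfl, ?_⟩
      rw [Nat.cast_sub hn]
      simp
  obtain ⟨q, hq, hnest⟩ := exists_nested_isBinaryOptimal (μ := μ) n ℱ V hVm hVi
  have h0 := hq m hm.le
  have h1 := hq (m + 1) hm
  have o0 := h0.isOptimal hVm hVi le_rfl hm.le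
  have o1 := h1.isOptimal hVm hVi le_rfl hm
  have hbin : ∀ k < n, ∀ ω, q m k ω = q (m + 1) k ω ∨ (q m k ω = 0 ∧ q (m + 1) k ω = 1) := by
    intro k hk ω
    have := hnest m hm k hk ω
    rcases h0.control.binary k hk ω trivial with e | e <;>
    rcases h1.control.binary k hk ω trivial with e' | e' <;> simp [e, e']
    linarith
  have hadm : IsAdmissible ℱ n (m + s, m + s)
      (fun k ω => (1 - s) * q m k ω + s * q (m + 1) k ω) := by
    refine ⟨fun k hk => ((o0.1.1 k hk).const_mul _).add ((o1.1.1 k hk).const_mul _),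
      fun k hk ω => (convex_Icc (0 : ℝ) 1) (o0.1.2.1 k hk ω) (o1.1.2.1 k hk ω)
        (sub_nonneg.2 hs1) hs0 (by ring), fun ω => ?_⟩
    have e0 := le_antisymm (o0.1.2.2 ω).2 (o0.1.2.2 ω).1
    have e1 := le_antisymm (o1.1.2.2 ω).2 (o1.1.2.2 ω).1
    have e : ∑ k ∈ Finset.range n, ((1 - s) * q m k ω + s * q (m + 1) k ω) = m + s := by
      rw [Finset.sum_add_distrib, ← Finset.mul_sum, ← Finset.mul_sum, e0, e1]
      push_cast
      ring
    rw [e]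
    exact ⟨le_rfl, le_rfl⟩
  refine ⟨_, ⟨hadm, ?_⟩, fun ω => ?_⟩
  · filter_upwards [reward_convexComb (ℱ := ℱ) (o0.1.integrable_payoff hVi)
      (o1.1.integrable_payoff hVi) (1 - s) s, o0.2, o1.2,
      premium_eq_interpolation hVi hr (natCast_mem_constraintSet le_rfl hm.le),
      premium_eq_interpolation hVi hr (natCast_mem_constraintSet le_rfl hm),
      premium_eq_interpolation hVi hr (Q := (m + s, m + s)) ⟨hv0, le_rfl, hvn⟩]
      with ω e e0 e1 i0 i1 i2
    rw [e, e0, e1, i0, i1, i2]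
    simp only [hatWeight_diag _ _ _ hs0 hs1, Finset.mul_sum, ← Finset.sum_add_distrib]
    exact Finset.sum_congr rfl fun i _ => Finset.sum_congr rfl fun j _ => by ring
  · -- the differences of the two controls are `0` or `1` and sum to `1`
    have hd : ∀ k < n, (1 - s) * q m k ω + s * q (m + 1) k ω ∈ Set.Ioo (0 : ℝ) 1 →
        q m k ω = 0 ∧ q (m + 1) k ω = 1 := by
      intro k hk hmem
      refine (hbin k hk ω).resolve_left fun e => ?_
      rcases h0.control.binary k hk ω trivial with e' | e' <;> rw [← e, e'] at hmem <;>
        simp at hmem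
    have hsum : ∑ k ∈ Finset.range n, (q (m + 1) k ω - q m k ω) ≤ 1 := by
      rw [Finset.sum_sub_distrib]
      have e0 := (o0.1.2.2 ω).1
      have e1 := (o1.1.2.2 ω).2
      push_cast at e0 e1
      linarith
    intro k ⟨hk, hk'⟩ l ⟨hl, hl'⟩
    by_contra hkl
    have a := hd k hk hk'
    have b := hd l hl hl'
    have hsub : ({k, l} : Finset ℕ) ⊆ Finset.range n := by
      intro x hx
      simp only [Finset.mem_insert, Finset.mem_singleton] at hx
      rcases hx with rfl | rfl <;> simpa
    have := Finset.sum_le_sum_of_subset_of_nonneg hsub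
      (f := fun k => q (m + 1) k ω - q m k ω) fun x hx _ =>
      sub_nonneg.2 (hnest m hm x (Finset.mem_range.1 hx) ω)
    rw [Finset.sum_pair hkl, a.1, a.2, b.1, b.2] at this
    linarith

end

/-! ### An example without bang-bang optimal control -/

section

/-- With payoffs `V₀ = 1/4` and `V₁ = ±1`, each sign having probability `1/2` and being unknown at
time `0`, and with constraints `(0, 3/2)`, every optimal control has `q₀ = 1/2`, so as to keep
exactly one full right for time `1`. When `V₁ = -1` this right is not used: then `q₀` is
fractional, while the total quantity `1/2` saturates neither constraint. -/
theorem exists_forall_isOptimal_not_isBangBang :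
    ∃ (Ω' : Type) (mΩ' : MeasurableSpace Ω') (μ' : Measure Ω') (ℱ' : Filtration ℕ mΩ')
        (V' : ℕ → Ω' → ℝ) (Q : ℝ × ℝ),
      IsProbabilityMeasure μ' ∧ (∀ k < 2, Measurable[ℱ' k] (V' k)) ∧
      (∀ k < 2, Integrable (V' k) μ') ∧ Q ∈ constraintSet 2 ∧
      ∀ q, IsOptimal μ' ℱ' 2 V' Q q → ¬ IsBangBang μ' 2 Q q := by
  let μ : Measure Bool :=
    (2 : ENNReal)⁻¹ • Measure.dirac true + (2 : ENNReal)⁻¹ • Measure.dirac false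
  let ℱ : Filtration ℕ (inferInstance : MeasurableSpace Bool) :=
    { seq := fun k => if k = 0 then ⊥ else ⊤
      mono' := fun a b h => by
        by_cases ha : a = 0
        · simp [ha]
        · have : b ≠ 0 := by omega
          simp [ha, this]
      le' := fun k => le_top }
  let V : ℕ → Bool → ℝ := fun k ω => if k = 0 then 1 / 4 else if ω then 1 else -1
  have hμ : IsProbabilityMeasure μ := ⟨by simp [μ, ENNReal.inv_two_add_inv_two]⟩
  have hsing : ∀ ω, μ {ω} = 2⁻¹ := fun ω => by cases ω <;> simp [μ]
  have hae : ∀ p : Bool → Prop, (∀ᵐ ω ∂μ, p ω) → ∀ ω, p ω := fun p hp ω => by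
    by_contra h
    have h0 := measure_mono_null (Set.singleton_subset_iff.2 h) (ae_iff.1 hp)
    simp [hsing] at h0
  have hint : ∀ f : Bool → ℝ, ∫ ω, f ω ∂μ = (f true + f false) / 2 := fun f => by
    rw [integral_fintype .of_finite]
    simp [Measure.real, hsing]
    ring
  have hF0 : ℱ 0 = ⊥ := rfl
  have hF1 : ℱ 1 = ⊤ := rfl
  have hVm : ∀ k < 2, Measurable[ℱ k] (V k) := fun k hk => by
    obtain rfl | rfl : k = 0 ∨ k = 1 := by omega
    · exact measurable_const
    · rw [hF1]
      exact measurable_from_top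
  have hVi : ∀ k < 2, Integrable (V k) μ := fun k _ => .of_finite
  have hQ : ((0, 3 / 2) : ℝ × ℝ) ∈ constraintSet 2 := by
    refine ⟨?_, ?_, ?_⟩ <;> norm_num
  refine ⟨Bool, inferInstance, μ, ℱ, V, (0, 3 / 2), hμ, hVm, hVi, hQ, fun q hq hbb => ?_⟩
  have hrew : ∀ p : ℕ → Bool → ℝ, ∀ ω, reward μ ℱ 2 V p ω =
      ((p 0 true / 4 + p 1 true) + (p 0 false / 4 - p 1 false)) / 2 := fun p ω => by
    rw [reward, hF0, condExp_bot, hint]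
    simp [Finset.sum_range_succ, V]
    ring
  obtain ⟨q₀, hq₀⟩ : ∃ q₀, q 0 = fun _ => q₀ := by
    refine ⟨q 0 true, ?_⟩
    have h := hq.1.1 0 two_pos (measurableSet_singleton (q 0 true))
    rw [hF0, MeasurableSpace.measurableSet_bot_iff] at h
    rcases h with h | h
    · exact absurd (show true ∈ q 0 ⁻¹' {q 0 true} from rfl) (by simp [h])
    · ext ω
      exact (h ▸ Set.mem_univ ω : ω ∈ q 0 ⁻¹' {q 0 true})
  -- the control keeping one full right for time `1`
  let p : ℕ → Bool → ℝ := fun k ω => if k = 0 then 1 / 2 else if ω then 1 else 0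
  have hp : IsAdmissible ℱ 2 (0, 3 / 2) p := by
    refine ⟨fun k hk => ?_, fun k hk ω => ?_, fun ω => ?_⟩
    · obtain rfl | rfl : k = 0 ∨ k = 1 := by omega
      · exact measurable_const
      · rw [hF1]
        exact measurable_from_top
    · simp only [p]
      split_ifs <;> norm_num
    · cases ω <;> norm_num [Finset.sum_range_succ, p]
  obtain ⟨r, hr⟩ := exists_family_isBinaryOptimal hVm hVi
  have hess := (isOptimal_mixedControl hVi hr hQ).1
  have hle : reward μ ℱ 2 V p true ≤ reward μ ℱ 2 V q true :=
    hae (fun ω => reward μ ℱ 2 V p ω ≤ reward μ ℱ 2 V q ω)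
      ((hess.2.1 _ ⟨p, hp, rfl⟩).trans hq.2.symm.le) true
  have ht := (hq.1.2.2 true).2
  have h1t := hq.1.2.1 1 one_lt_two true
  have h1f := hq.1.2.1 1 one_lt_two false
  rw [hrew, hrew] at hle
  simp only [Finset.sum_range_succ, Finset.sum_range_zero, zero_add, hq₀, p] at hle ht
  norm_num at hle
  -- the optimality inequality `hle` and the constraints can only hold with equality
  have e1 : q 1 false = 0 := by linarith [h1t.1, h1t.2, h1f.1]
  have e0 : q₀ = 1 / 2 := by linarith [h1t.1, h1t.2, h1f.1]
  have hf := hae _ hbb false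
  rcases hf with h | ⟨-, h⟩
  · have := h 0 two_pos
    rw [hq₀, e0] at this
    norm_num at this
  · rw [Finset.sum_range_succ, Finset.sum_range_one, e1, hq₀, e0] at h
    norm_num at h

end

end Swing

/-! ### Value function and optimal controls -/

theorem mainTheorem2 {Ω : Type*} [mΩ : MeasurableSpace Ω] (μ : Measure Ω) [IsProbabilityMeasure μ]
    (n : ℕ) (ℱ : Filtration ℕ mΩ) (V : ℕ → Ω → ℝ)
    (hVadapted : ∀ k < n, Measurable[ℱ k] (V k)) (hVint : ∀ k < n, Integrable (V k) μ) :
    -- the premium is well defined and is attained by an optimal control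
    (∀ Q ∈ Swing.constraintSet n,
      Swing.IsEssSup μ (Swing.rewardSet μ ℱ n V Q) (Swing.premium μ ℱ n V Q) ∧
      ∃ q, Swing.IsOptimal μ ℱ n V Q q) ∧
    -- (a) the premium has a version, as a process indexed by `Q`, with regular paths
    (∃ P : ℝ × ℝ → Ω → ℝ,
      (∀ Q ∈ Swing.constraintSet n,
        Measurable[ℱ 0] (P Q) ∧ P Q =ᵐ[μ] Swing.premium μ ℱ n V Q) ∧
      (∀ ω, ConcaveOn ℝ (Swing.constraintSet n) (fun Q => P Q ω) ∧
        ContinuousOn (fun Q => P Q ω) (Swing.constraintSet n) ∧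
        (∀ i j : ℕ, i ≤ j → j < n →
          Swing.IsAffineOn (fun Q => P Q ω) (Swing.upperTriangle i j)) ∧
        (∀ i j : ℕ, i < j → j < n →
          Swing.IsAffineOn (fun Q => P Q ω) (Swing.lowerTriangle i j))) ∧
      ((∀ k < n, 0 ≤ᵐ[μ] V k) →
        ∀ᵐ ω ∂μ, MonotoneOn (fun v : ℝ => P (v, v) ω) (Set.Icc 0 (n : ℝ)))) ∧
    -- (a) explicit values
    Swing.premium μ ℱ n V (0, 0) =ᵐ[μ] 0 ∧
    Swing.premium μ ℱ n V (0, n) =ᵐ[μ]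
      μ[fun ω => ∑ k ∈ Finset.range n, max (V k ω) 0 | ℱ 0] ∧
    Swing.premium μ ℱ n V (n, n) =ᵐ[μ] μ[fun ω => ∑ k ∈ Finset.range n, V k ω | ℱ 0] ∧
    -- (a) nonnegative payoffs
    ((∀ k < n, 0 ≤ᵐ[μ] V k) → ∀ Q ∈ Swing.constraintSet n,
      Swing.premium μ ℱ n V Q =ᵐ[μ] Swing.premium μ ℱ n V (0, Q.2) ∧
      Swing.premium μ ℱ n V Q =ᵐ[μ] Swing.premium μ ℱ n V (Q.2, Q.2)) ∧
    -- (b) integral constraints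
    (∀ a b : ℕ, a ≤ b → b ≤ n →
      ∃ q, Swing.IsOptimal μ ℱ n V ((a : ℝ), (b : ℝ)) q ∧
        Swing.IsBangBang μ n ((a : ℝ), (b : ℝ)) q ∧
        ∀ k < n, ∀ ω, q k ω = 0 ∨ q k ω = 1) ∧
    -- (b) nonnegative payoffs
    ((∀ k < n, 0 ≤ᵐ[μ] V k) → ∀ Q ∈ Swing.constraintSet n,
      ∃ q, Swing.IsOptimal μ ℱ n V Q q ∧ Swing.IsBangBang μ n Q q ∧
        ∀ ω, ∑ k ∈ Finset.range n, q k ω = Q.2) ∧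
    -- (b) in general there is no bang-bang optimal control, already for two periods
    (∃ (Ω' : Type) (mΩ' : MeasurableSpace Ω') (μ' : Measure Ω') (ℱ' : Filtration ℕ mΩ')
        (V' : ℕ → Ω' → ℝ) (Q : ℝ × ℝ),
      IsProbabilityMeasure μ' ∧ (∀ k < 2, Measurable[ℱ' k] (V' k)) ∧
      (∀ k < 2, Integrable (V' k) μ') ∧ Q ∈ Swing.constraintSet 2 ∧
      ∀ q, Swing.IsOptimal μ' ℱ' 2 V' Q q → ¬ Swing.IsBangBang μ' 2 Q q) := by
  obtain ⟨r, hr⟩ := Swing.exists_family_isBinaryOptimal hVadapted hVint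
  have hopt : ∀ Q ∈ Swing.constraintSet n,
      Swing.IsEssSup μ (Swing.rewardSet μ ℱ n V Q) (Swing.premium μ ℱ n V Q) ∧
      ∃ q, Swing.IsOptimal μ ℱ n V Q q := fun Q hQ =>
    ⟨(Swing.isOptimal_mixedControl hVint hr hQ).1, _, (Swing.isOptimal_mixedControl hVint hr hQ).2⟩
  have hess := fun Q hQ => (hopt Q hQ).1
  have h00 : ((0, 0) : ℝ × ℝ) ∈ Swing.constraintSet n := ⟨le_rfl, le_rfl, n.cast_nonneg⟩
  have h0n : ((0, n) : ℝ × ℝ) ∈ Swing.constraintSet n := ⟨le_rfl, n.cast_nonneg, le_rfl⟩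
  have hnn : ((n, n) : ℝ × ℝ) ∈ Swing.constraintSet n := ⟨n.cast_nonneg, le_rfl, le_rfl⟩
  refine ⟨hopt, ?_, ?_, ?_, ?_, ?_, ?_, ?_, Swing.exists_forall_isOptimal_not_isBangBang⟩
  · obtain ⟨P, hP, hreg⟩ := Swing.exists_regular_version (μ := μ) (m := ℱ 0) n
      (A := fun i j => Swing.reward μ ℱ n V (r i j))
      (fun i j => stronglyMeasurable_condExp.measurable)
      (fun Q hQ => Swing.premium_eq_interpolation hVint hr hQ)
      (fun Q hQ Q' hQ' s t => Swing.premium_concave hVint hopt hQ hQ')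
    refine ⟨P, hP, fun ω => ⟨(hreg ω).1, (hreg ω).2.1.continuousOn,
      fun i j _ _ => (hreg ω).2.2.1 i j, fun i j _ _ => (hreg ω).2.2.2 i j⟩, fun hV => ?_⟩
    exact Swing.ae_monotoneOn_diag hVint hV hess (fun Q hQ => (hP Q hQ).2) fun ω => (hreg ω).2.1
  · obtain ⟨q, hq⟩ := (hopt _ h00).2
    exact Swing.premium_zero_zero hq
  · exact Swing.premium_zero_natCast hVadapted hVint (hess _ h0n)
  · obtain ⟨q, hq⟩ := (hopt _ hnn).2
    exact Swing.premium_natCast_natCast hq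
  · exact fun hV Q hQ => Swing.premium_eq_of_nonneg hVint hV hess hQ
  · intro a b hab hbn
    have ho := (hr a b hab hbn).isOptimal hVadapted hVint hab hbn
    have hbin : ∀ k < n, ∀ ω, r a b k ω = 0 ∨ r a b k ω = 1 := fun k hk ω =>
      (hr a b hab hbn).control.binary k hk ω trivial
    exact ⟨r a b, ho, Swing.isBangBang_of_binary ho.1 hbin, hbin⟩
  · intro hV Q hQ
    obtain ⟨q, hq, hbb⟩ := Swing.exists_isBangBang_diag hVadapted hVint
      (hQ.1.trans hQ.2.1) hQ.2.2
    have hsum : ∀ ω, ∑ k ∈ Finset.range n, q k ω = Q.2 := fun ω =>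
      le_antisymm (hq.1.2.2 ω).2 (hq.1.2.2 ω).1
    refine ⟨q, ⟨hq.1.mono hQ.2.1 le_rfl,
      hq.2.trans (Swing.premium_eq_of_nonneg hVint hV hess hQ).2.symm⟩,
      Filter.Eventually.of_forall fun ω => Or.inr ⟨(hbb ω).anti fun k hk => ?_,
        Or.inr (hsum ω)⟩, hsum⟩
    exact ⟨hk.1, hk.2.1, hk.2.2.trans_le (min_le_left _ _)⟩
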